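/- Let $X\neq\{0\}$ be a complex Banach space. For $x\in X$ put $J(x)=\{x^*\in X^*:\langle x,x^*\rangle=\|x\|^2=\|x^*\|^2\}$, and for $r>0$ let $\mathcal B_r=\{x\in X:\|x\|<r\}$. Let $R>0$, let $h:\mathcal B_R\to X$ be holomorphic, and set $$N_R=\sup\{\mathrm{Re}\langle h(x),x^*\rangle:\ \|x\|<R,\ x^*\in J(x)\},\qquad L=\sup\{\mathrm{Re}\langle h'(0)u,u^*\rangle:\ \|u\|=1,\ u^*\in J(u)\},$$ and assume $N_R<\infty$. The vector field $-h$ is called semi-complete on $\mathcal B_r$, $0<r\le R$, if for every $x_0\in\mathcal B_r$ the Cauchy problem $x'(t)=h(x(t))$, $x(0)=x_0$, has a solution on $[0,\infty)$ with values in $\mathcal B_r$; it is called locally semi-complete if it is semi-complete on $\mathcal B_r$ for some $r\in(0,R)$. Put $b=N_R/R^2$, $c=\|h(0)\|$ and $$\mu(r)=\frac{R-r}{R+r}L+\frac{2r}{R+r}b+\frac cr\Bigl(1-\frac{r^2}{R^2}\Bigr),\qquad 0<r\le R.$$ (1) Let $h(0)\ne0$, and put $$\beta=\frac{\sqrt{c^2+2R(b-L)c}-c}{c},\qquad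 r_*=R\,\frac{\beta-\sqrt{\beta^2-4}}{2}.$$ If $R\bigl(\frac{N_R}{R^2}-L\bigr)>4\|h(0)\|$ and $\mu(r_*)<0$, then the equation $\mu(r)=0$ has exactly two roots $r_1<r_2$ in $(0,R]$, these satisfy $0<r_1<r_*<r_2\le R$, and $-h$ is semi-complete on $\mathcal B_r$ for every $r\in(r_1,r_2)$. (2) Let $h(0)=0$. If $L\neq 0$, then $-h$ is locally semi-complete if and only if $L<\min\{0,N_R/R^2\}$. If $L<\min\{0,N_R/R^2\}$, then $-h$ is semi-complete on $\mathcal B_r$ for every $r\in\Bigl(0,\dfrac{-R^3L}{2N_R-LR^2}\Bigr)$. -/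

import Mathlib

/-- The normalized duality map: `J x` is the set of continuous linear functionals `f` with
`f x = ‖x‖² = ‖f‖²`. -/
def dualityMap {X : Type*} [NormedAddCommGroup X] [NormedSpace ℂ X] (x : X) :
    Set (X →L[ℂ] ℂ) :=
  {f | f x = ((‖x‖ ^ 2 : ℝ) : ℂ) ∧ ‖f‖ ^ 2 = ‖x‖ ^ 2}

/-- The set of all values `Re ⟨h x, f⟩` with `x ∈ D` and `f ∈ J x`. -/
def reNumericalValues {X : Type*} [NormedAddCommGroup X] [NormedSpace ℂ X]
    (h : X → X) (D : Set X) : Set ℝ :=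
  {t | ∃ x ∈ D, ∃ f ∈ dualityMap x, t = (f (h x)).re}

/-- `N_R`, the supremum of `Re ⟨h x, f⟩` over `‖x‖ < R`, `f ∈ J x`.
It is meaningful when the set of these values is bounded above (that is, `N_R < ∞`). -/
noncomputable def numericalSup {X : Type*} [NormedAddCommGroup X] [NormedSpace ℂ X]
    (h : X → X) (R : ℝ) : ℝ :=
  sSup (reNumericalValues h (Metric.ball 0 R))

/-- `L`, the supremum of `Re ⟨h'(0) u, f⟩` over `‖u‖ = 1`, `f ∈ J u`.
The set of these values is always bounded, by the norm of the derivative. -/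
noncomputable def derivNumericalSup {X : Type*} [NormedAddCommGroup X] [NormedSpace ℂ X]
    (h : X → X) : ℝ :=
  sSup (reNumericalValues (fun u => fderiv ℂ h 0 u) (Metric.sphere 0 1))

/-- `f` is a semi-complete vector field on `D`: for every initial point in `D` the Cauchy problem
`x' + f (x) = 0`, `x 0 = x₀`, has a solution on `[0, ∞)` with values in `D`
(so that for `f = -h` the equation is `x' = h (x)`). -/
def IsSemiComplete {X : Type*} [NormedAddCommGroup X] [NormedSpace ℂ X]
    (f : X → X) (D : Set X) : Prop :=
  ∀ x₀ ∈ D, ∃ x : ℝ → X, x 0 = x₀ ∧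
    ∀ t : ℝ, 0 ≤ t → x t ∈ D ∧ HasDerivWithinAt x (-f (x t)) (Set.Ici 0) t

/-- A vector field on the ball of radius `R` is locally semi-complete if it is semi-complete on
some concentric ball of radius `r ∈ (0, R)`. -/
def IsLocallySemiComplete {X : Type*} [NormedAddCommGroup X] [NormedSpace ℂ X]
    (f : X → X) (R : ℝ) : Prop :=
  ∃ r ∈ Set.Ioo 0 R, IsSemiComplete f (Metric.ball 0 r)

/-- The function `μ (r)`, with `b = N_R / R²` and `c = ‖h 0‖`. -/
noncomputable def muFun (R L b c r : ℝ) : ℝ :=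
  (R - r) / (R + r) * L + 2 * r / (R + r) * b + c / r * (1 - r ^ 2 / R ^ 2)

/-- The constant `β`. -/
noncomputable def betaConst (R L b c : ℝ) : ℝ :=
  (√(c ^ 2 + 2 * R * (b - L) * c) - c) / c

/-- The point `r_*`. -/
noncomputable def rStar (R L b c : ℝ) : ℝ :=
  R * ((betaConst R L b c - √(betaConst R L b c ^ 2 - 4)) / 2)

open Metric Set Filter Topology ComplexConjugate

/-! For a unit vector `u` with norming functional `g`, put φ(z) = g(h(zu)), so that Re(z̄φ(z)) ≤ N_R
on |z| < R. The function q(z) = (φ(z) − φ(0))/z + conj(φ(0))z/R² is holomorphic, and on |z| = R its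
real part would equal Re(φ(z)/z). The maximum principle gives Re q ≤ N_R/R², while q(0) = g(h'(0)u)
has real part at most L. Harnack's inequality then yields Re⟨h(x), x*⟩ ≤ r²μ(r) for ‖x‖ = r
(`re_le_sq_mul_muFun`).

If μ(r) < 0, the field points strictly inward on the sphere of radius r, so no trajectory can leave
the ball (`norm_lt_of_inward`). Global existence requires h to be bounded and Lipschitz on the
closed ball. This is Harris' theorem: a one-sided numerical bound controls the norm on every smaller
ball (`exists_norm_le_of_bddAbove_reNumericalValues`).

What remains in (1) is algebra: r(R+r)μ(r) is a cubic which is strictly convex on [0,R], positive at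
0 and nonnegative at R, so one negative value forces exactly two roots. For h(0) = 0 it is r times
an affine function. Conversely, on an invariant ball the outward component of h tends to 0 at the
boundary, and the maximum principle for q gives L ≤ 0. -/

/-! ### Maximum principle and Harnack inequality in the disc. -/

/-- Maximum modulus principle for `exp ∘ f`, whose modulus is the exponential of the real part of
`f`. -/
theorem Complex.re_le_of_forall_mem_sphere {f : ℂ → ℂ} {R s B : ℝ} (hs : 0 < s) (hsR : s < R)
    (hf : DifferentiableOn ℂ f (ball 0 R)) (hB : ∀ z, ‖z‖ = s → (f z).re ≤ B)
    {z : ℂ} (hz : ‖z‖ ≤ s) : (f z).re ≤ B := by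
  have hsub : closedBall (0 : ℂ) s ⊆ ball 0 R := closedBall_subset_ball hsR
  have hd : DiffContOnCl ℂ (fun z => Complex.exp (f z)) (ball 0 s) := by
    refine DifferentiableOn.diffContOnCl ?_
    rw [closure_ball _ hs.ne']
    exact (hf.mono hsub).cexp
  have := Complex.norm_le_of_forall_mem_frontier_norm_le isBounded_ball hd (C := Real.exp B)
    (fun w hw => by
      rw [frontier_ball _ hs.ne', mem_sphere_zero_iff_norm] at hw
      rw [Complex.norm_exp]
      exact Real.exp_le_exp.2 (hB w hw)) (z := z)
    (by rw [closure_ball _ hs.ne']; simpa using hz)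
  rw [Complex.norm_exp] at this
  exact Real.exp_le_exp.1 this

/-- Harnack's inequality for the real part of a holomorphic function bounded above. -/
theorem Complex.re_le_harnack {q : ℂ → ℂ} {R b : ℝ} (hR : 0 < R)
    (hq : DifferentiableOn ℂ q (ball 0 R)) (hb : ∀ z ∈ ball (0 : ℂ) R, (q z).re ≤ b)
    {z : ℂ} (hz : z ∈ ball (0 : ℂ) R) :
    (q z).re ≤ (R - ‖z‖) / (R + ‖z‖) * (q 0).re + 2 * ‖z‖ / (R + ‖z‖) * b := by
  have hzR : ‖z‖ < R := by simpa using hz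
  have hz0 := norm_nonneg z
  have key : ∀ ε > 0, (R + ‖z‖) * (b + ε - (q z).re) ≥ (R - ‖z‖) * (b + ε - (q 0).re) := by
    intro ε hε
    set a : ℝ := b + ε - (q 0).re with ha
    have ha0 : 0 < a := by have := hb 0 (by simpa using hR); linarith
    -- `P` has positive real part, strictly because of ε, and the imaginary shift makes `P 0 = a`
    -- real. The Cayley transform `W` then fixes 0 and maps into the unit disc, so the Schwarz lemma
    -- applies.
    let P : ℂ → ℂ := fun w => (b + ε : ℝ) - q w + ((q 0).im : ℝ) * Complex.I
    have hPre : ∀ w, (P w).re = b + ε - (q w).re := by intro w; simp [P]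
    have hP0 : P 0 = (a : ℂ) := by
      apply Complex.ext <;> simp [P, ha]
    have hPpos : ∀ w ∈ ball (0 : ℂ) R, 0 < (P w).re := by
      intro w hw; rw [hPre]; have := hb w hw; linarith
    have hne : ∀ w ∈ ball (0 : ℂ) R, P w + a ≠ 0 := by
      intro w hw h0
      have := congrArg Complex.re h0
      simp only [Complex.add_re, Complex.ofReal_re, Complex.zero_re] at this
      have := hPpos w hw; linarith
    have hPd : DifferentiableOn ℂ P (ball 0 R) := (hq.const_sub _).add_const _
    let W : ℂ → ℂ := fun w => (P w - a) / (P w + a)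
    have hWd : DifferentiableOn ℂ W (ball 0 R) := (hPd.sub_const _).div (hPd.add_const _) hne
    have hW0 : W 0 = 0 := by simp [W, hP0]
    have hsq : ∀ p : ℂ, ‖p - a‖ ^ 2 = (p.re - a) ^ 2 + p.im ^ 2 ∧
        ‖p + a‖ ^ 2 = (p.re + a) ^ 2 + p.im ^ 2 := by
      intro p
      constructor <;> rw [Complex.sq_norm, Complex.normSq_apply] <;> simp <;> ring
    have hmaps : MapsTo W (ball 0 R) (closedBall (W 0) 1) := by
      intro w hw
      rw [hW0, mem_closedBall_zero_iff, norm_div]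
      refine div_le_one_of_le₀ ?_ (norm_nonneg _)
      refine le_of_sq_le_sq ?_ (norm_nonneg _)
      rw [(hsq _).1, (hsq _).2]
      nlinarith [hPpos w hw]
    have h1 := Complex.dist_le_div_mul_dist_of_mapsTo_ball hWd hmaps hz
    rw [hW0, dist_zero_right, dist_zero_right, norm_div] at h1
    have hpos : 0 < ‖P z + a‖ := norm_pos_iff.2 (hne z hz)
    rw [div_le_iff₀ hpos] at h1
    have h2 : R * ‖P z - a‖ ≤ ‖z‖ * ‖P z + a‖ := by
      have := mul_le_mul_of_nonneg_left h1 hR.le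
      have e : R * (1 / R * ‖z‖ * ‖P z + a‖) = ‖z‖ * ‖P z + a‖ := by field_simp
      linarith
    have h3 : (R * ‖P z - a‖) ^ 2 ≤ (‖z‖ * ‖P z + a‖) ^ 2 := by gcongr
    rw [mul_pow, mul_pow, (hsq _).1, (hsq _).2] at h3
    -- The imaginary parts can be dropped because ‖z‖ ≤ R.
    have h4 : (R * (a - (P z).re)) ^ 2 ≤ (‖z‖ * ((P z).re + a)) ^ 2 := by
      have : ‖z‖ ^ 2 * (P z).im ^ 2 ≤ R ^ 2 * (P z).im ^ 2 := by gcongr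
      nlinarith
    have h5 := abs_le_of_sq_le_sq h4 (mul_nonneg hz0 (by have := hPpos z hz; linarith))
    have h6 := (le_abs_self _).trans h5
    rw [hPre] at h6
    nlinarith
  have key' : (R + ‖z‖) * (b - (q z).re) ≥ (R - ‖z‖) * (b - (q 0).re) := by
    by_contra hcon
    push Not at hcon
    set d := (R - ‖z‖) * (b - (q 0).re) - (R + ‖z‖) * (b - (q z).re) with hd
    have hd0 : 0 < d := by linarith
    -- The ε-terms in `key` contribute 2‖z‖ε in total, which this ε keeps below the defect `d`.
    have := key (d / (2 * (2 * R))) (by positivity)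
    have e : 2 * ‖z‖ * (d / (2 * (2 * R))) < d := by
      rw [mul_div_assoc', div_lt_iff₀ (by positivity)]
      nlinarith
    nlinarith
  have hRz : 0 < R + ‖z‖ := by linarith
  rw [div_mul_eq_mul_div, div_mul_eq_mul_div, ← add_div, le_div_iff₀ hRz]
  nlinarith

/-! ### The regularized quotient. -/

/-- Removing the singularity of `φ z / z` without changing its real part on the circle of
radius `R`. -/
noncomputable def regularizedQuotient (φ : ℂ → ℂ) (R : ℝ) (z : ℂ) : ℂ :=
  dslope φ 0 z + conj (φ 0) * z / (R : ℂ) ^ 2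

theorem regularizedQuotient_zero (φ : ℂ → ℂ) (R : ℝ) :
    regularizedQuotient φ R 0 = deriv φ 0 := by
  simp [regularizedQuotient]

theorem differentiableOn_regularizedQuotient {φ : ℂ → ℂ} {R : ℝ} (hR : 0 < R)
    (hφ : DifferentiableOn ℂ φ (ball 0 R)) :
    DifferentiableOn ℂ (regularizedQuotient φ R) (ball 0 R) := by
  have := (Complex.differentiableOn_dslope (ball_mem_nhds (0 : ℂ) hR)).2 hφ
  unfold regularizedQuotient
  fun_prop

theorem eq_add_mul_regularizedQuotient (φ : ℂ → ℂ) (R : ℝ) (z : ℂ) :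
    φ z = φ 0 + z * (regularizedQuotient φ R z - conj (φ 0) * z / (R : ℂ) ^ 2) := by
  have := sub_smul_dslope φ 0 z
  simp only [sub_zero, smul_eq_mul] at this
  simp [regularizedQuotient, this]

/-- The added term works because z·conj(φ(0)) and z̄·φ(0) are conjugate, hence have equal real
parts. The correction vanishes on |z| = R. -/
theorem re_conj_mul_eq (φ : ℂ → ℂ) (R : ℝ) (z : ℂ) :
    (conj z * φ z).re = ‖z‖ ^ 2 * (regularizedQuotient φ R z).re
      + (1 - ‖z‖ ^ 2 / R ^ 2) * (conj z * φ 0).re := by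
  have e := eq_add_mul_regularizedQuotient φ R z
  have : conj z * φ z = ((‖z‖ ^ 2 : ℝ) : ℂ) * regularizedQuotient φ R z + conj z * φ 0
      - ((‖z‖ ^ 2 / R ^ 2 : ℝ) : ℂ) * (z * conj (φ 0)) := by
    rw [e]
    have : ((‖z‖ ^ 2 : ℝ) : ℂ) = conj z * z := by
      rw [mul_comm, Complex.mul_conj, Complex.normSq_eq_norm_sq]
    push_cast at this ⊢
    rw [this]; ring
  rw [this, Complex.sub_re, Complex.add_re, Complex.re_ofReal_mul, Complex.re_ofReal_mul]
  have : (z * conj (φ 0)).re = (conj z * φ 0).re := by simp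
  rw [this]; ring

theorem regularizedQuotient_re_le {φ : ℂ → ℂ} {R N : ℝ} (hR : 0 < R)
    (hφ : DifferentiableOn ℂ φ (ball 0 R))
    (hN : ∀ z ∈ ball (0 : ℂ) R, (conj z * φ z).re ≤ N) {z : ℂ} (hz : z ∈ ball (0 : ℂ) R) :
    (regularizedQuotient φ R z).re ≤ N / R ^ 2 := by
  have hzR : ‖z‖ < R := by simpa using hz
  -- `φ` need not extend to |z| = R, so the bound is taken on |w| = s, where the correction costs at
  -- most the second term, and then s → R.
  let B : ℝ → ℝ := fun s => N / s ^ 2 + (1 / s ^ 2 - 1 / R ^ 2) * (s * ‖φ 0‖)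
  have hB : Tendsto B (𝓝[<] R) (𝓝 (N / R ^ 2)) := by
    have : ContinuousAt B R := by
      have := hR.ne'
      fun_prop (disch := positivity)
    have h := this.tendsto
    simp only [B, sub_self, zero_mul, add_zero] at h
    exact h.mono_left nhdsWithin_le_nhds
  refine ge_of_tendsto hB ?_
  filter_upwards [Ioo_mem_nhdsLT hzR] with s hs
  have hs0 : 0 < s := (norm_nonneg z).trans_lt hs.1
  refine Complex.re_le_of_forall_mem_sphere hs0 hs.2
    (differentiableOn_regularizedQuotient hR hφ) ?_ hs.1.le
  intro w hw
  have h1 := hN w (by simpa [hw] using hs.2)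
  rw [re_conj_mul_eq φ R w, hw] at h1
  have h2 : -(s * ‖φ 0‖) ≤ (conj w * φ 0).re := by
    have := Complex.abs_re_le_norm (conj w * φ 0)
    rw [norm_mul, Complex.norm_conj, hw] at this
    exact (abs_le.1 this).1
  have h3 : 0 ≤ 1 - s ^ 2 / R ^ 2 := by
    rw [sub_nonneg, div_le_one (by positivity)]
    exact pow_le_pow_left₀ hs0.le hs.2.le 2
  have h4 : s ^ 2 * (regularizedQuotient φ R w).re ≤ N + (1 - s ^ 2 / R ^ 2) * (s * ‖φ 0‖) := by
    nlinarith
  have h5 : B s = (N + (1 - s ^ 2 / R ^ 2) * (s * ‖φ 0‖)) / s ^ 2 := by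
    simp only [B]; field_simp
  rw [h5, le_div_iff₀ (by positivity)]
  linarith

/-! ### Growth of numerical values along complex lines. -/

section Growth

variable {X : Type*} [NormedAddCommGroup X] [NormedSpace ℂ X]

theorem zero_mem_reNumericalValues (h : X → X) {R : ℝ} (hR : 0 < R) :
    (0 : ℝ) ∈ reNumericalValues h (ball 0 R) :=
  ⟨0, by simpa using hR, 0, by simp [dualityMap], by simp⟩

theorem numericalSup_nonneg {h : X → X} {R : ℝ} (hR : 0 < R)
    (hN : BddAbove (reNumericalValues h (ball 0 R))) : 0 ≤ numericalSup h R :=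
  le_csSup hN (zero_mem_reNumericalValues h hR)

theorem smul_mem_dualityMap {u : X} {g : X →L[ℂ] ℂ} (hu : ‖u‖ = 1) (hg : ‖g‖ = 1) (hgu : g u = 1)
    (z : ℂ) : conj z • g ∈ dualityMap (z • u) := by
  constructor
  · rw [norm_smul, hu, mul_one]
    simp only [map_smul, smul_apply, smul_eq_mul, hgu, mul_one]
    rw [Complex.mul_conj, Complex.normSq_eq_norm_sq]
  · rw [norm_smul, norm_smul, hu, hg, Complex.norm_conj]

theorem exists_unit_of_mem_dualityMap {x : X} (hx : x ≠ 0) {f : X →L[ℂ] ℂ}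
    (hf : f ∈ dualityMap x) : ∃ (u : X) (g : X →L[ℂ] ℂ), ‖u‖ = 1 ∧ ‖g‖ = 1 ∧ g u = 1 ∧
      x = (‖x‖ : ℂ) • u ∧ f = (‖x‖ : ℂ) • g := by
  have hx0 : 0 < ‖x‖ := norm_pos_iff.2 hx
  have hxc : (‖x‖ : ℂ) ≠ 0 := by exact_mod_cast hx0.ne'
  have hfn : ‖f‖ = ‖x‖ := (pow_left_inj₀ (norm_nonneg _) (norm_nonneg _) two_ne_zero).1 hf.2
  refine ⟨(‖x‖ : ℂ)⁻¹ • x, (‖x‖ : ℂ)⁻¹ • f, ?_, ?_, ?_, ?_, ?_⟩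
  · rw [norm_smul, norm_inv, Complex.norm_real, norm_norm, inv_mul_cancel₀ hx0.ne']
  · rw [norm_smul, norm_inv, Complex.norm_real, norm_norm, hfn, inv_mul_cancel₀ hx0.ne']
  · simp only [map_smul, smul_apply, smul_eq_mul, hf.1]
    push_cast; field_simp
  · rw [smul_inv_smul₀ hxc]
  · rw [smul_inv_smul₀ hxc]

theorem mem_dualityMap_of_unit {u : X} {g : X →L[ℂ] ℂ} (hu : ‖u‖ = 1) (hg : ‖g‖ = 1)
    (hgu : g u = 1) : g ∈ dualityMap u := by
  simpa using smul_mem_dualityMap hu hg hgu 1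

/-- Existence of norming functionals. -/
theorem dualityMap_nonempty (x : X) : (dualityMap x).Nonempty := by
  rcases eq_or_ne x 0 with rfl | hx
  · exact ⟨0, by simp [dualityMap]⟩
  · obtain ⟨g, hg, hgx⟩ := exists_dual_vector ℂ x (by simpa using hx)
    refine ⟨(‖x‖ : ℂ) • g, ?_, ?_⟩
    · simp [hgx, sq]
    · simp [norm_smul, hg]

/-- The slice of a holomorphic map along a complex line through the origin is holomorphic. -/
theorem differentiableOn_slice {h : X → X} {R : ℝ} (hh : DifferentiableOn ℂ h (ball 0 R))
    {u : X} (hu : ‖u‖ = 1) : DifferentiableOn ℂ (fun z : ℂ => h (z • u)) (ball 0 R) := by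
  refine hh.comp (Differentiable.differentiableOn (by fun_prop)) ?_
  intro z hz
  simpa [norm_smul, hu] using hz

theorem re_conj_mul_slice_le {h : X → X} {R : ℝ}
    (hN : BddAbove (reNumericalValues h (ball 0 R))) {u : X} {g : X →L[ℂ] ℂ} (hu : ‖u‖ = 1)
    (hg : ‖g‖ = 1) (hgu : g u = 1) (z : ℂ) (hz : z ∈ ball (0 : ℂ) R) :
    (conj z * g (h (z • u))).re ≤ numericalSup h R := by
  refine le_csSup hN ⟨z • u, by simpa [norm_smul, hu] using hz, conj z • g,
    smul_mem_dualityMap hu hg hgu z, by simp⟩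

theorem deriv_slice_zero {h : X → X} {R : ℝ} (hR : 0 < R)
    (hh : DifferentiableOn ℂ h (ball 0 R)) (u : X) (g : X →L[ℂ] ℂ) :
    deriv (fun z : ℂ => g (h (z • u))) 0 = g (fderiv ℂ h 0 u) := by
  have h0 : DifferentiableAt ℂ h ((0 : ℂ) • u) := by
    rw [zero_smul]; exact hh.differentiableAt (ball_mem_nhds 0 hR)
  have h1 : HasDerivAt (fun z : ℂ => z • u) ((1 : ℂ) • u) 0 := (hasDerivAt_id (0 : ℂ)).smul_const u
  have h2 := h0.hasFDerivAt.comp_hasDerivAt (0 : ℂ) h1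
  have h3 := (g.hasFDerivAt.comp_hasDerivAt (0 : ℂ) h2).deriv
  simpa [Function.comp_def] using h3

theorem re_fderiv_le_derivNumericalSup (h : X → X) {u : X} {g : X →L[ℂ] ℂ} (hu : ‖u‖ = 1)
    (hg : ‖g‖ = 1) (hgu : g u = 1) : (g (fderiv ℂ h 0 u)).re ≤ derivNumericalSup h := by
  refine le_csSup ⟨‖fderiv ℂ h 0‖, ?_⟩
    ⟨u, by simpa using hu, g, mem_dualityMap_of_unit hu hg hgu, rfl⟩
  rintro t ⟨x, hx, f, hf, rfl⟩
  have hx1 : ‖x‖ = 1 := by simpa using hx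
  have hf1 : ‖f‖ = 1 := by
    have := hf.2
    rw [hx1] at this
    exact (pow_left_inj₀ (norm_nonneg _) zero_le_one two_ne_zero).1 (by simpa using this)
  calc (f (fderiv ℂ h 0 x)).re ≤ ‖f (fderiv ℂ h 0 x)‖ := Complex.re_le_norm _
    _ ≤ ‖f‖ * (‖fderiv ℂ h 0‖ * ‖x‖) :=
      (f.le_opNorm _).trans (by gcongr; exact ContinuousLinearMap.le_opNorm _ _)
    _ = ‖fderiv ℂ h 0‖ := by rw [hf1, hx1]; ring

/-- The growth estimate for the numerical values of a holomorphic map. -/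
theorem re_le_sq_mul_muFun {h : X → X} {R : ℝ} (hR : 0 < R)
    (hh : DifferentiableOn ℂ h (ball 0 R)) (hN : BddAbove (reNumericalValues h (ball 0 R)))
    {x : X} (hx : x ≠ 0) (hxR : ‖x‖ < R) {f : X →L[ℂ] ℂ} (hf : f ∈ dualityMap x) :
    (f (h x)).re ≤
      ‖x‖ ^ 2 * muFun R (derivNumericalSup h) (numericalSup h R / R ^ 2) ‖h 0‖ ‖x‖ := by
  obtain ⟨u, g, hu, hg, hgu, hxu, hfg⟩ := exists_unit_of_mem_dualityMap hx hf
  have hr0 : 0 < ‖x‖ := norm_pos_iff.2 hx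
  set r := ‖x‖ with hr
  let φ : ℂ → ℂ := fun z => g (h (z • u))
  have hφ : DifferentiableOn ℂ φ (ball 0 R) :=
    g.differentiable.comp_differentiableOn (differentiableOn_slice hh hu)
  have hrn : ‖(r : ℂ)‖ = r := by rw [Complex.norm_real, Real.norm_of_nonneg hr0.le]
  have hrR : (r : ℂ) ∈ ball (0 : ℂ) R := by rw [mem_ball_zero_iff, hrn]; exact hxR
  have h1 := re_conj_mul_eq φ R r
  have h2 := Complex.re_le_harnack hR (differentiableOn_regularizedQuotient hR hφ)
    (fun z hz => regularizedQuotient_re_le hR hφ (re_conj_mul_slice_le hN hu hg hgu) hz) hrR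
  rw [regularizedQuotient_zero, deriv_slice_zero hR hh] at h2
  rw [hrn] at h1 h2
  have h3 := re_fderiv_le_derivNumericalSup h hu hg hgu
  have h4 : (conj (r : ℂ) * φ 0).re ≤ r * ‖h 0‖ := by
    refine (Complex.re_le_norm _).trans ?_
    rw [norm_mul, Complex.norm_conj, hrn]
    gcongr
    have := g.le_opNorm (h ((0 : ℂ) • u))
    rw [hg, one_mul] at this
    simpa [φ] using this
  have e : f (h x) = conj (r : ℂ) * φ r := by
    rw [hfg]
    simp only [smul_apply, smul_eq_mul, Complex.conj_ofReal, φ]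
    rw [← hxu]
  rw [e, h1]
  have h5 : 0 ≤ 1 - r ^ 2 / R ^ 2 := by
    rw [sub_nonneg, div_le_one (by positivity)]
    exact pow_le_pow_left₀ hr0.le hxR.le 2
  have h6 : (R - r) / (R + r) * (g (fderiv ℂ h 0 u)).re ≤
      (R - r) / (R + r) * derivNumericalSup h :=
    mul_le_mul_of_nonneg_left h3 (div_nonneg (by linarith) (by linarith))
  have h7 := mul_le_mul_of_nonneg_left h4 h5
  have h8 := mul_le_mul_of_nonneg_left (h2.trans (add_le_add_left h6 _)) (sq_nonneg r)
  refine (add_le_add h8 h7).trans (le_of_eq ?_)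
  unfold muFun
  field_simp

/-- The numerical values of `h` on a smaller ball are bounded in modulus. -/
theorem exists_norm_slice_le {h : X → X} {R s : ℝ} (hR : 0 < R) (hs : 0 ≤ s) (hsR : s < R)
    (hh : DifferentiableOn ℂ h (ball 0 R)) (hN : BddAbove (reNumericalValues h (ball 0 R))) :
    ∃ C, 0 ≤ C ∧ ∀ (u : X) (g : X →L[ℂ] ℂ), ‖u‖ = 1 → ‖g‖ = 1 → g u = 1 →
      ∀ z : ℂ, ‖z‖ ≤ s → ‖g (h (z • u))‖ ≤ C := by
  -- The added 1 makes `M` positive for Borel–Carathéodory, which turns the one-sided bound on Re q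
  -- into the bound `Q` on |q|, uniform in `u` and `g`.
  set M : ℝ := |numericalSup h R / R ^ 2| + 1 with hM
  set A := ‖fderiv ℂ h 0‖
  have hRs : 0 < R - s := by linarith
  set Q : ℝ := 2 * M * s / (R - s) + A * (R + s) / (R - s) with hQ
  have hQ0 : 0 ≤ Q := by positivity
  refine ⟨‖h 0‖ + s * (Q + ‖h 0‖ * s / R ^ 2), by positivity, ?_⟩
  intro u g hu hg hgu z hz
  let φ : ℂ → ℂ := fun z => g (h (z • u))
  have hφ : DifferentiableOn ℂ φ (ball 0 R) :=
    g.differentiable.comp_differentiableOn (differentiableOn_slice hh hu)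
  have hzR : z ∈ ball (0 : ℂ) R := by simpa using hz.trans_lt hsR
  have hq0 : ‖regularizedQuotient φ R 0‖ ≤ A := by
    rw [regularizedQuotient_zero, deriv_slice_zero hR hh]
    calc ‖g (fderiv ℂ h 0 u)‖ ≤ ‖g‖ * (A * ‖u‖) :=
      (g.le_opNorm _).trans (by gcongr; exact ContinuousLinearMap.le_opNorm _ _)
      _ = A := by rw [hg, hu]; ring
  have hRz : 0 < R - ‖z‖ := by linarith
  have hq : ‖regularizedQuotient φ R z‖ ≤ Q := by
    refine (Complex.borelCaratheodory (M := M) (by positivity)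
      (differentiableOn_regularizedQuotient hR hφ) (fun w hw => ?_) hR hzR).trans ?_
    · have := regularizedQuotient_re_le hR hφ (re_conj_mul_slice_le hN hu hg hgu) hw
      have h2 := le_abs_self (numericalSup h R / R ^ 2)
      show _ ≤ M
      linarith
    · rw [hQ]; gcongr
  have h0 : ‖φ 0‖ ≤ ‖h 0‖ := by
    have := g.le_opNorm (h ((0 : ℂ) • u))
    rw [hg, one_mul] at this
    simpa [φ] using this
  show ‖φ z‖ ≤ _
  rw [eq_add_mul_regularizedQuotient φ R z]
  refine (norm_add_le _ _).trans ?_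
  rw [norm_mul]
  gcongr
  refine (norm_sub_le _ _).trans ?_
  rw [norm_div, norm_mul, Complex.norm_conj, norm_pow, Complex.norm_real, Real.norm_of_nonneg hR.le]
  gcongr

end Growth

/-! ### Homogeneous Taylor parts: Cauchy estimates and holomorphy. -/

section Homogeneous

variable {X : Type*} [NormedAddCommGroup X] [NormedSpace ℂ X]

/-- The `m`-th homogeneous part of `h` at the origin, evaluated at `x`. -/
noncomputable def homogeneousPart (h : X → X) (m : ℕ) (x : X) : X :=
  (m.factorial : ℂ)⁻¹ • iteratedDeriv m (fun z : ℂ => h (z • x)) 0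

theorem isOpen_slice_domain {X : Type*} [NormedAddCommGroup X] (R : ℝ) (x : X) : IsOpen {z : ℂ | ‖z‖ * ‖x‖ < R} :=
  isOpen_lt (by fun_prop) continuous_const

theorem differentiableOn_slice_domain {h : X → X} {R : ℝ}
    (hh : DifferentiableOn ℂ h (ball 0 R)) (x : X) :
    DifferentiableOn ℂ (fun z : ℂ => h (z • x)) {z | ‖z‖ * ‖x‖ < R} := by
  refine hh.comp (Differentiable.differentiableOn (by fun_prop)) ?_
  intro z hz
  simpa [norm_smul] using hz

theorem closedBall_subset_slice_domain {X : Type*} [NormedAddCommGroup X] {R ρ : ℝ} {x : X} (hρ : ρ * ‖x‖ < R) :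
    closedBall (0 : ℂ) ρ ⊆ {z : ℂ | ‖z‖ * ‖x‖ < R} := by
  intro z hz
  exact lt_of_le_of_lt (mul_le_mul_of_nonneg_right (by simpa using hz) (norm_nonneg _)) hρ

variable [CompleteSpace X]

theorem contDiffAt_slice_zero {h : X → X} {R : ℝ} (hR : 0 < R)
    (hh : DifferentiableOn ℂ h (ball 0 R)) (x : X) (m : ℕ) :
    ContDiffAt ℂ m (fun z : ℂ => h (z • x)) 0 :=
  ((differentiableOn_slice_domain hh x).contDiffOn (isOpen_slice_domain R x)).contDiffAt
    ((isOpen_slice_domain R x).mem_nhds (by simpa using hR))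

theorem norm_apply_homogeneousPart_le {F : Type*} [NormedAddCommGroup F] [NormedSpace ℂ F]
    [CompleteSpace F] {h : X → X} {R ρ C : ℝ} (hR : 0 < R)
    (hh : DifferentiableOn ℂ h (ball 0 R)) (A : X →L[ℂ] F) (m : ℕ) {x : X} (hρ : 0 < ρ)
    (hρx : ρ * ‖x‖ < R) (hC : ∀ z : ℂ, ‖z‖ = ρ → ‖A (h (z • x))‖ ≤ C) :
    ‖A (homogeneousPart h m x)‖ ≤ C / ρ ^ m := by
  have e : A (iteratedDeriv m (fun z : ℂ => h (z • x)) 0) =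
      iteratedDeriv m (fun z : ℂ => A (h (z • x))) 0 := by
    rw [iteratedDeriv_eq_iteratedFDeriv, iteratedDeriv_eq_iteratedFDeriv]
    have := A.iteratedFDeriv_comp_left (contDiffAt_slice_zero hR hh x m) (i := m) le_rfl
    simp only [Function.comp_def] at this
    rw [this]; rfl
  have hd : DiffContOnCl ℂ (fun z : ℂ => A (h (z • x))) (ball 0 ρ) :=
    DifferentiableOn.diffContOnCl_ball
      (A.differentiable.comp_differentiableOn (differentiableOn_slice_domain hh x))
      (closedBall_subset_slice_domain hρx)
  have := Complex.norm_iteratedDeriv_le_of_forall_mem_sphere_norm_le m hρ hd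
    (fun z hz => hC z (by simpa using hz))
  unfold homogeneousPart
  rw [map_smul, e, norm_smul, norm_inv, Complex.norm_natCast]
  have hf : (0 : ℝ) < m.factorial := by exact_mod_cast m.factorial_pos
  rw [inv_mul_le_iff₀ hf, ← mul_div_assoc]
  exact this

theorem norm_homogeneousPart_sub_le {h : X → X} {R ρ C : ℝ} (hR : 0 < R)
    (hh : DifferentiableOn ℂ h (ball 0 R)) (m : ℕ) {x y : X} (hρ : 0 < ρ)
    (hρx : ρ * ‖x‖ < R) (hρy : ρ * ‖y‖ < R)
    (hC : ∀ z : ℂ, ‖z‖ = ρ → ‖h (z • x) - h (z • y)‖ ≤ C) :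
    ‖homogeneousPart h m x - homogeneousPart h m y‖ ≤ C / ρ ^ m := by
  have hd : DiffContOnCl ℂ ((fun z : ℂ => h (z • x)) - fun z : ℂ => h (z • y)) (ball 0 ρ) :=
    (DifferentiableOn.diffContOnCl_ball (differentiableOn_slice_domain hh x)
      (closedBall_subset_slice_domain hρx)).sub
    (DifferentiableOn.diffContOnCl_ball (differentiableOn_slice_domain hh y)
      (closedBall_subset_slice_domain hρy))
  have := Complex.norm_iteratedDeriv_le_of_forall_mem_sphere_norm_le m hρ hd
    (fun z hz => hC z (by simpa using hz))
  rw [iteratedDeriv_sub (contDiffAt_slice_zero hR hh x m) (contDiffAt_slice_zero hR hh y m)] at this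
  unfold homogeneousPart
  rw [← smul_sub, norm_smul, norm_inv, Complex.norm_natCast]
  have hf : (0 : ℝ) < m.factorial := by exact_mod_cast m.factorial_pos
  rw [inv_mul_le_iff₀ hf, ← mul_div_assoc]
  exact this

theorem hasSum_homogeneousPart {h : X → X} {R : ℝ} (hh : DifferentiableOn ℂ h (ball 0 R))
    {x : X} {z : ℂ} (hz : ‖z‖ * ‖x‖ < R) :
    HasSum (fun m => z ^ m • homogeneousPart h m x) (h (z • x)) := by
  obtain ⟨t, ht, hzt⟩ : ∃ t, t * ‖x‖ < R ∧ ‖z‖ < t := by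
    have : ∀ᶠ t in 𝓝[>] ‖z‖, t * ‖x‖ < R :=
      nhdsWithin_le_nhds ((continuous_id.mul continuous_const).continuousAt.eventually_lt
        continuousAt_const hz)
    obtain ⟨t, h1, h2⟩ := (this.and self_mem_nhdsWithin).exists
    exact ⟨t, h1, h2⟩
  have := Complex.hasSum_taylorSeries_on_ball (c := 0) (r := t) (z := z)
    ((differentiableOn_slice_domain hh x).mono
      (ball_subset_closedBall.trans (closedBall_subset_slice_domain ht))) (by simpa using hzt)
  refine this.congr_fun fun m => ?_
  simp only [sub_zero, homogeneousPart]
  rw [smul_comm]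

/-- Exhibits the m-th part as a limit of rescaled Taylor remainders as s → 0, at a rate uniform in
`x`. The Taylor tail is dominated by a geometric series of ratio ‖s‖/ρ ≤ 1/2. -/
theorem norm_homogeneousPart_remainder_le {h : X → X} {R ρ M : ℝ} (hR : 0 < R)
    (hh : DifferentiableOn ℂ h (ball 0 R)) (hρ : 0 < ρ) {x : X} (hρx : ρ * ‖x‖ < R)
    (hM : ∀ z : ℂ, ‖z‖ = ρ → ‖h (z • x)‖ ≤ M) (m : ℕ) {s : ℂ} (hs0 : s ≠ 0)
    (hs : ‖s‖ ≤ ρ / 2) :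
    ‖(s ^ m)⁻¹ • (h (s • x) - ∑ k ∈ Finset.range m, s ^ k • homogeneousPart h k x)
      - homogeneousPart h m x‖ ≤ 2 * M / ρ ^ (m + 1) * ‖s‖ := by
  have hsn : 0 < ‖s‖ := norm_pos_iff.2 hs0
  have hM0 : 0 ≤ M := (norm_nonneg _).trans (hM ρ (by simp [abs_of_pos hρ]))
  have hsx : ‖s‖ * ‖x‖ < R :=
    lt_of_le_of_lt (mul_le_mul_of_nonneg_right (by linarith) (norm_nonneg _)) hρx
  have h1 := (hasSum_nat_add_iff' (m + 1)).2 (hasSum_homogeneousPart hh hsx)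
  have hb : ∀ k, ‖s ^ (k + (m + 1)) • homogeneousPart h (k + (m + 1)) x‖ ≤
      M * (‖s‖ / ρ) ^ (m + 1) * (1 / 2) ^ k := by
    intro k
    have h2 := norm_apply_homogeneousPart_le hR hh (ContinuousLinearMap.id ℂ X) (k + (m + 1))
      hρ hρx (C := M) (fun z hz => hM z hz)
    simp only [ContinuousLinearMap.id_apply] at h2
    rw [norm_smul, norm_pow]
    calc ‖s‖ ^ (k + (m + 1)) * ‖homogeneousPart h (k + (m + 1)) x‖
        ≤ ‖s‖ ^ (k + (m + 1)) * (M / ρ ^ (k + (m + 1))) := by gcongr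
      _ = M * (‖s‖ / ρ) ^ (m + 1) * (‖s‖ / ρ) ^ k := by
        rw [mul_assoc, ← pow_add, add_comm (m + 1), div_pow]; ring
      _ ≤ _ := by
        have : ‖s‖ / ρ ≤ 1 / 2 := by rw [div_le_iff₀ hρ]; linarith
        gcongr
  have h3 := h1.norm_le_of_bounded
    ((hasSum_geometric_two).mul_left (M * (‖s‖ / ρ) ^ (m + 1))) hb
  rw [Finset.sum_range_succ] at h3
  have e : (s ^ m)⁻¹ • (h (s • x) - ∑ k ∈ Finset.range m, s ^ k • homogeneousPart h k x)
      - homogeneousPart h m x = (s ^ m)⁻¹ • (h (s • x) -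
        (∑ k ∈ Finset.range m, s ^ k • homogeneousPart h k x + s ^ m • homogeneousPart h m x)) := by
    rw [← sub_sub, smul_sub (s ^ m)⁻¹ (_ - _), inv_smul_smul₀ (pow_ne_zero m hs0)]
  rw [e, norm_smul, norm_inv, norm_pow, inv_mul_le_iff₀ (by positivity)]
  refine h3.trans (le_of_eq ?_)
  rw [div_pow, pow_succ ‖s‖]
  field_simp

/-- The homogeneous parts are holomorphic along holomorphic curves. -/
theorem differentiableOn_homogeneousPart_comp {h : X → X} {R ρ M B : ℝ} (hR : 0 < R)
    (hh : DifferentiableOn ℂ h (ball 0 R)) (hρ : 0 < ρ) (hB : ρ * B < R)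
    (hM : ∀ x : X, ‖x‖ ≤ ρ * B → ‖h x‖ ≤ M) {V : Set ℂ} (hV : IsOpen V) {y : ℂ → X}
    (hy : DifferentiableOn ℂ y V) (hyB : ∀ t ∈ V, ‖y t‖ ≤ B) (m : ℕ) :
    DifferentiableOn ℂ (fun t => homogeneousPart h m (y t)) V := by
  induction m using Nat.strong_induction_on with
  | _ m ih =>
  let F : ℂ → ℂ → X := fun s t =>
    (s ^ m)⁻¹ • (h (s • y t) - ∑ k ∈ Finset.range m, s ^ k • homogeneousPart h k (y t))
  have hsmall : ∀ᶠ s : ℂ in 𝓝[≠] 0, s ≠ 0 ∧ ‖s‖ ≤ ρ / 2 := by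
    refine eventually_mem_nhdsWithin.and (nhdsWithin_le_nhds ?_)
    filter_upwards [closedBall_mem_nhds (0 : ℂ) (half_pos hρ)] with s hs
    simpa using hs
  have hρy : ∀ t ∈ V, ρ * ‖y t‖ < R := fun t ht =>
    lt_of_le_of_lt (mul_le_mul_of_nonneg_left (hyB t ht) hρ.le) hB
  -- By induction each `F s` is holomorphic in `t`, and a uniform limit of holomorphic maps is
  -- holomorphic.
  have hlim : TendstoUniformlyOn F (fun t => homogeneousPart h m (y t)) (𝓝[≠] 0) V := by
    rw [Metric.tendstoUniformlyOn_iff]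
    intro ε hε
    have h0 : Tendsto (fun s : ℂ => 2 * M / ρ ^ (m + 1) * ‖s‖) (𝓝[≠] 0) (𝓝 0) := by
      have : Continuous (fun s : ℂ => 2 * M / ρ ^ (m + 1) * ‖s‖) := by fun_prop
      have := this.tendsto 0
      simp only [norm_zero, mul_zero] at this
      exact this.mono_left nhdsWithin_le_nhds
    filter_upwards [hsmall, h0.eventually_lt_const hε] with s hs hsε t ht
    rw [dist_comm, dist_eq_norm]
    refine (norm_homogeneousPart_remainder_le hR hh hρ (hρy t ht) (M := M) (fun z hz => ?_)
      m hs.1 hs.2).trans_lt hsε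
    refine hM _ ?_
    rw [norm_smul, hz]
    exact mul_le_mul_of_nonneg_left (hyB t ht) hρ.le
  refine hlim.tendstoLocallyUniformlyOn.differentiableOn ?_ hV
  filter_upwards [hsmall] with s hs
  refine DifferentiableOn.const_smul (DifferentiableOn.sub ?_ ?_) _
  · refine hh.comp (hy.const_smul s) ?_
    intro t ht
    rw [mem_ball_zero_iff, norm_smul]
    exact lt_of_le_of_lt (mul_le_mul_of_nonneg_right (by linarith [hs.2]) (norm_nonneg _))
      (hρy t ht)
  · exact DifferentiableOn.fun_sum fun k hk =>
      (ih k (Finset.mem_range.1 hk)).const_smul _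

end Homogeneous

/-! ### Harris' theorem: from numerical bounds to norm bounds. -/

section Harris

variable {X : Type*} [NormedAddCommGroup X] [NormedSpace ℂ X]

/-- The norming functional is taken at the endpoint w = y + τP(y), so ‖w‖ ≤ ‖y‖ + |τ|·|g(P y)|.
Replacing P y by P w costs a Lipschitz error K·rM and brings in the numerical bound at `w`. The
growth rate per step thus depends on `v`, up to an error that vanishes with the step. -/
theorem norm_eulerStep_le {P : X → X} {M K v : ℝ} {m : ℕ} (hv0 : 0 ≤ v) (hK0 : 0 ≤ K)
    (hM : ∀ x, ‖x‖ ≤ 3 → ‖P x‖ ≤ M)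
    (hK : ∀ x y, ‖x‖ ≤ 3 → ‖y‖ ≤ 3 → ‖P x - P y‖ ≤ K * ‖x - y‖)
    (hv : ∀ (x : X) (g : X →L[ℂ] ℂ), x ≠ 0 → ‖g‖ = 1 → g x = ‖x‖ → ‖g (P x)‖ ≤ v * ‖x‖ ^ m)
    {y : X} (hy : ‖y‖ ≤ 2) {τ : ℂ} {r : ℝ} (hτ : ‖τ‖ ≤ r) (hrM : r * M ≤ 1) :
    ‖y + τ • P y‖ ≤ ‖y‖ + r * (v * (‖y‖ + r * M) ^ m + K * (r * M)) := by
  have hr0 : 0 ≤ r := (norm_nonneg _).trans hτ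
  have hM0 : 0 ≤ M := (norm_nonneg _).trans (hM y (by linarith))
  set w := y + τ • P y with hw
  have hτP : ‖τ • P y‖ ≤ r * M := by
    rw [norm_smul]
    exact mul_le_mul hτ (hM y (by linarith)) (norm_nonneg _) hr0
  have hwn : ‖w‖ ≤ ‖y‖ + r * M := (norm_add_le _ _).trans (by linarith)
  rcases eq_or_ne w 0 with h0 | h0
  · rw [h0, norm_zero]; positivity
  obtain ⟨g, hg, hgw⟩ := exists_dual_vector ℂ w (norm_ne_zero_iff.2 h0)
  have hgle : ∀ x, ‖g x‖ ≤ ‖x‖ := fun x => by simpa [hg] using g.le_opNorm x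
  have h1 : ‖g (P w)‖ ≤ v * (‖y‖ + r * M) ^ m :=
    (hv w g h0 hg hgw).trans (by gcongr)
  have h2 : ‖P y - P w‖ ≤ K * (r * M) := by
    refine (hK y w (by linarith) (by linarith)).trans ?_
    gcongr
    rw [hw, sub_add_cancel_left, norm_neg]
    exact hτP
  have h3 : ‖g (P y)‖ ≤ v * (‖y‖ + r * M) ^ m + K * (r * M) := by
    have e : g (P y) = g (P w) + g (P y - P w) := by rw [map_sub]; ring
    rw [e]
    exact (norm_add_le _ _).trans (add_le_add h1 ((hgle _).trans h2))
  have h4 : ‖w‖ = ‖g w‖ := by rw [hgw]; simp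
  rw [h4, hw, map_add, map_smul, smul_eq_mul]
  refine (norm_add_le _ _).trans (add_le_add (hgle y) ?_)
  rw [norm_mul]
  exact mul_le_mul hτ h3 (norm_nonneg _) hr0

/-- The iterates of the explicit Euler scheme for `x' = P x` with step `t / n` started at `u`. -/
noncomputable def eulerIterate (P : X → X) (n : ℕ) (u : X) : ℕ → ℂ → X
  | 0, _ => u
  | k + 1, t => eulerIterate P n u k t + (t / n) • P (eulerIterate P n u k t)

/-- A map that is bounded in modulus numerically by `v ‖x‖ ^ m` is bounded in norm on the unit
sphere. -/
theorem norm_le_of_numerical_bound {P : X → X} {M K v A : ℝ} {m : ℕ} (hv0 : 0 ≤ v) (hK0 : 0 ≤ K)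
    (hM : ∀ x, ‖x‖ ≤ 3 → ‖P x‖ ≤ M)
    (hK : ∀ x y, ‖x‖ ≤ 3 → ‖y‖ ≤ 3 → ‖P x - P y‖ ≤ K * ‖x - y‖)
    (hd : ∀ (V : Set ℂ) (y : ℂ → X), IsOpen V → DifferentiableOn ℂ y V →
      (∀ t ∈ V, ‖y t‖ ≤ 3) → DifferentiableOn ℂ (fun t => P (y t)) V)
    (hv : ∀ (x : X) (g : X →L[ℂ] ℂ), x ≠ 0 → ‖g‖ = 1 → g x = ‖x‖ → ‖g (P x)‖ ≤ v * ‖x‖ ^ m)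
    (hA : v * Real.exp 1 < A) {u : X} (hu : ‖u‖ = 1) : ‖P u‖ ≤ 3 * ((m + 1) * A) := by
  have hA0 : 0 < A := lt_of_le_of_lt (by positivity) hA
  -- With growth rate at most `A`, time T keeps norms below 1 + 1/(m+1) ≤ 2, and (1 + 1/(m+1))^m ≤
  -- e, which is what makes the rate self-consistent.
  set T : ℝ := 1 / ((m + 1) * A) with hT
  have hT0 : 0 < T := by positivity
  have hM0 : 0 ≤ M := (norm_nonneg _).trans (hM u (by linarith))
  have hTA : T * A = 1 / (m + 1) := by rw [hT]; field_simp
  have hm1 : (1 : ℝ) / (m + 1) ≤ 1 := by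
    rw [div_le_one (by positivity)]
    have : (0 : ℝ) ≤ m := by positivity
    linarith
  have hexp : (1 + 1 / ((m : ℝ) + 1)) ^ m ≤ Real.exp 1 := by
    have h1 : 1 + 1 / ((m : ℝ) + 1) ≤ Real.exp (1 / (m + 1)) := by
      have := Real.add_one_le_exp (1 / ((m : ℝ) + 1)); linarith
    calc (1 + 1 / ((m : ℝ) + 1)) ^ m ≤ Real.exp (1 / (m + 1)) ^ m := by gcongr
      _ = Real.exp (m * (1 / (m + 1))) := by rw [← Real.exp_nat_mul]
      _ ≤ Real.exp 1 := by
        rw [Real.exp_le_exp, mul_one_div, div_le_one (by positivity)]; linarith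
  -- The strict inequality v·e < A absorbs the discretization error. One large `n` suffices: the
  -- derivative in complex time at 0 of the n-step iterate is exactly `P u`.
  obtain ⟨n, hn0, hn1, hn2⟩ : ∃ n : ℕ, 0 < n ∧ T / n * M ≤ 1 ∧
      v * (1 + 1 / ((m : ℝ) + 1) + T / n * M) ^ m + K * (T / n * M) ≤ A := by
    have h0 : Tendsto (fun n : ℕ => T / n) atTop (𝓝 0) := tendsto_const_div_atTop_nhds_zero_nat T
    have c1 : Continuous fun x : ℝ => x * M := by fun_prop
    have c2 : Continuous fun x : ℝ => v * (1 + 1 / ((m : ℝ) + 1) + x * M) ^ m + K * (x * M) := by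
      fun_prop
    have e1 := (c1.tendsto 0).comp h0
    have e2 := (c2.tendsto 0).comp h0
    simp only [zero_mul, mul_zero, add_zero] at e1 e2
    have f1 := e1.eventually_le_const one_pos
    have f2 := e2.eventually_le_const (u := A)
      ((mul_le_mul_of_nonneg_left hexp hv0).trans_lt hA)
    obtain ⟨n, hn⟩ := ((eventually_gt_atTop 0).and (f1.and f2)).exists
    exact ⟨n, hn⟩
  have hnR : (0 : ℝ) < n := by exact_mod_cast hn0
  have hkn : ∀ k : ℕ, k ≤ n → k * (T / n * A) ≤ 1 / (m + 1) := by
    intro k hk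
    have hk' : (k : ℝ) ≤ n := by exact_mod_cast hk
    calc k * (T / n * A) ≤ n * (T / n * A) := by gcongr
      _ = T * A := by field_simp
      _ = _ := hTA
  have main : ∀ k : ℕ, k ≤ n → DifferentiableOn ℂ (eulerIterate P n u k) (ball 0 T) ∧
      (∀ t ∈ ball (0 : ℂ) T, ‖eulerIterate P n u k t‖ ≤ 1 + k * (T / n * A)) ∧
      eulerIterate P n u k 0 = u ∧
      HasDerivAt (eulerIterate P n u k) (((k : ℂ) / n) • P u) 0 := by
    intro k
    induction k with
    | zero =>
      intro _
      refine ⟨differentiableOn_const _, fun t _ => by simp [eulerIterate, hu], rfl, ?_⟩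
      rw [Nat.cast_zero, zero_div, zero_smul]
      exact hasDerivAt_const (0 : ℂ) u
    | succ k ih =>
      intro hk
      obtain ⟨i1, i2, i3, i4⟩ := ih (by omega)
      have hk' := hkn k (by omega)
      have hP : DifferentiableOn ℂ (fun t => P (eulerIterate P n u k t)) (ball 0 T) :=
        hd _ _ isOpen_ball i1 fun t ht => (i2 t ht).trans (by linarith)
      refine ⟨?_, ?_, ?_, ?_⟩
      · exact i1.add ((Differentiable.differentiableOn (by fun_prop)).smul hP)
      · intro t ht
        have ht' : ‖t / n‖ ≤ T / n := by
          rw [norm_div, Complex.norm_natCast]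
          have : ‖t‖ < T := by simpa using ht
          gcongr
        refine (norm_eulerStep_le hv0 hK0 hM hK hv ((i2 t ht).trans (by linarith)) ht' hn1).trans ?_
        have hle : ‖eulerIterate P n u k t‖ + T / n * M ≤ 1 + 1 / ((m : ℝ) + 1) + T / n * M := by
          linarith [i2 t ht]
        have h5 : v * (‖eulerIterate P n u k t‖ + T / n * M) ^ m + K * (T / n * M) ≤ A := by
          refine le_trans ?_ hn2
          gcongr
        have h6 : T / n * (v * (‖eulerIterate P n u k t‖ + T / n * M) ^ m + K * (T / n * M)) ≤
            T / n * A := by gcongr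
        push_cast
        linarith [i2 t ht]
      · simp [eulerIterate, i3]
      · have h7 : HasDerivAt (fun t : ℂ => t / n) (1 / n) 0 := (hasDerivAt_id (0 : ℂ)).div_const _
        have h8 := (hP.differentiableAt (ball_mem_nhds 0 hT0)).hasDerivAt
        have h9 := i4.add (h7.smul h8)
        have e : ((k + 1 : ℕ) : ℂ) / n = (k : ℂ) / n + 1 / n := by push_cast; ring
        rw [e, add_smul]
        simpa [i3, eulerIterate, Pi.add_def] using h9
  obtain ⟨j1, j2, j3, j4⟩ := main n le_rfl
  -- The radius 3 is 2 for the iterate plus 1 for `u`; the Cauchy estimate then gives ‖P u‖ ≤ 3/T.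
  have hmaps : MapsTo (eulerIterate P n u n) (ball 0 T)
      (closedBall (eulerIterate P n u n 0) 3) := by
    intro t ht
    rw [j3, mem_closedBall, dist_eq_norm]
    refine (norm_sub_le _ _).trans ?_
    linarith [j2 t ht, hkn n le_rfl]
  have := Complex.norm_deriv_le_div_of_mapsTo_ball j1 hmaps hT0
  rw [j4.deriv, div_self (by exact_mod_cast hn0.ne'), one_smul] at this
  refine this.trans (le_of_eq ?_)
  rw [hT]; field_simp

/-- A bounded holomorphic map is Lipschitz on smaller balls. -/
theorem norm_sub_le_of_bounded {h : X → X} {s s' M : ℝ} (hs : s < s')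
    (hh : DifferentiableOn ℂ h (ball 0 s')) (hM : ∀ x, ‖x‖ < s' → ‖h x‖ ≤ M) {x y : X}
    (hx : ‖x‖ ≤ s) (hy : ‖y‖ ≤ s) : ‖h x - h y‖ ≤ 2 * M / (s' - s) * ‖x - y‖ := by
  have hd : 0 < s' - s := by linarith
  have hMM : ‖h x - h y‖ ≤ 2 * M := by
    refine (norm_sub_le _ _).trans ?_
    linarith [hM x (by linarith), hM y (by linarith)]
  rcases lt_or_ge ‖x - y‖ (s' - s) with hlt | hge
  · have hsub : ball y (s' - s) ⊆ ball 0 s' := ball_subset_ball' (by simp; linarith)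
    have := Complex.dist_le_div_mul_dist_of_mapsTo_ball (c := y) (R₁ := s' - s) (R₂ := 2 * M)
      (z := x) (hh.mono hsub) ?_ (by simpa [dist_eq_norm] using hlt)
    · simpa [dist_eq_norm] using this
    · intro w hw
      rw [mem_closedBall, dist_eq_norm]
      refine (norm_sub_le _ _).trans ?_
      linarith [hM w (by simpa using hsub hw), hM y (by linarith)]
  · refine hMM.trans ?_
    rw [div_mul_eq_mul_div, le_div_iff₀ hd]
    have hM0 : 0 ≤ 2 * M := (norm_nonneg _).trans hMM
    gcongr

variable [CompleteSpace X]

/-- **Harris' theorem**: a holomorphic map whose numerical values are bounded above is bounded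
on smaller balls. -/
theorem exists_norm_le_of_bddAbove_reNumericalValues {h : X → X} {R s : ℝ} (hR : 0 < R)
    (hs : 0 ≤ s) (hsR : s < R) (hh : DifferentiableOn ℂ h (ball 0 R))
    (hN : BddAbove (reNumericalValues h (ball 0 R))) :
    ∃ M, ∀ x, ‖x‖ ≤ s → ‖h x‖ ≤ M := by
  obtain ⟨s₁, hs₁, hs₁R⟩ := exists_between hsR
  have hs₁0 : 0 < s₁ := hs.trans_lt hs₁
  obtain ⟨C, hC0, hC⟩ := exists_norm_slice_le hR hs₁0.le hs₁R hh hN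
  -- Continuity at 0 supplies the crude bound and Lipschitz constant that the Euler argument
  -- requires of each homogeneous part; neither enters its conclusion.
  obtain ⟨δ, hδ0, hδ⟩ : ∃ δ > 0, ∀ x : X, ‖x‖ < δ → x ∈ ball (0 : X) R ∧ ‖h x‖ ≤ ‖h 0‖ + 1 := by
    have hc : ContinuousAt h 0 := (hh.differentiableAt (ball_mem_nhds 0 hR)).continuousAt
    obtain ⟨δ, hδ0, hδ⟩ := Metric.eventually_nhds_iff.1
      ((eventually_mem_set.2 (ball_mem_nhds (0 : X) hR)).and
        (hc.norm.eventually_le_const (lt_add_one ‖h 0‖)))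
    exact ⟨δ, hδ0, fun x hx => hδ (by simpa using hx)⟩
  set M₀ := ‖h 0‖ + 1
  have hM₀ : 0 ≤ M₀ := by positivity
  have hhδ : DifferentiableOn ℂ h (ball 0 δ) := hh.mono fun x hx => (hδ x (by simpa using hx)).1
  set ρ := min δ R / 8 with hρ
  have hmin : 0 < min δ R := lt_min hδ0 hR
  have hρ0 : 0 < ρ := by positivity
  have hρδ : ρ * 3 ≤ δ / 2 := by have := min_le_left δ R; linarith
  have hρR : ρ * 3 < R := by have := min_le_right δ R; linarith
  have hρx : ∀ x : X, ‖x‖ ≤ 3 → ρ * ‖x‖ ≤ ρ * 3 := fun x hx => by gcongr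
  have hzx : ∀ (x : X) (z : ℂ), ‖x‖ ≤ 3 → ‖z‖ = ρ → ‖z • x‖ ≤ δ / 2 := fun x z hx hz => by
    rw [norm_smul, hz]; exact (hρx x hx).trans hρδ
  -- Cauchy's estimate on slices gives the numerical bound C/s₁^m. Using C + 1 makes it positive, so
  -- A = 3v strictly exceeds e·v. The resulting bound is linear in m over s₁^m, hence summable
  -- against s^m.
  have bound : ∀ (m : ℕ) (u : X), ‖u‖ = 1 →
      ‖homogeneousPart h m u‖ ≤ 3 * ((m + 1) * (3 * ((C + 1) / s₁ ^ m))) := by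
    intro m u hu
    have hv0 : 0 < (C + 1) / s₁ ^ m := by positivity
    refine norm_le_of_numerical_bound (M := M₀ / ρ ^ m)
      (K := 2 * M₀ / (δ - δ / 2) * ρ / ρ ^ m) (v := (C + 1) / s₁ ^ m) hv0.le ?_ ?_ ?_ ?_ ?_ ?_ hu
    · have : 0 < δ - δ / 2 := by linarith
      positivity
    · intro x hx
      exact norm_apply_homogeneousPart_le hR hh (ContinuousLinearMap.id ℂ X) m hρ0
        ((hρx x hx).trans_lt hρR) fun z hz => (hδ _ ((hzx x z hx hz).trans_lt (by linarith))).2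
    · intro x y hx hy
      rw [div_mul_eq_mul_div]
      refine norm_homogeneousPart_sub_le hR hh m hρ0 ((hρx x hx).trans_lt hρR)
        ((hρx y hy).trans_lt hρR) fun z hz => ?_
      refine (norm_sub_le_of_bounded (half_lt_self hδ0) hhδ (fun w hw => (hδ w hw).2)
        (hzx x z hx hz) (hzx y z hy hz)).trans (le_of_eq ?_)
      rw [← smul_sub, norm_smul, hz]; ring
    · intro V y hV hy hy3
      exact differentiableOn_homogeneousPart_comp hR hh hρ0 hρR
        (fun x hx => (hδ x (by linarith)).2) hV hy hy3 m
    · intro x g hx hg hgx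
      have hx0 : 0 < ‖x‖ := norm_pos_iff.2 hx
      have hxc : (‖x‖ : ℂ) ≠ 0 := by exact_mod_cast hx0.ne'
      have h1 := norm_apply_homogeneousPart_le hR hh g m (x := x) (ρ := s₁ / ‖x‖) (C := C)
        (by positivity) (by rwa [div_mul_cancel₀ _ hx0.ne']) fun z hz => by
          have e : z • x = (z * ‖x‖) • ((‖x‖ : ℂ)⁻¹ • x) := by
            rw [smul_smul, mul_assoc, mul_inv_cancel₀ hxc, mul_one]
          rw [e]
          refine hC _ g ?_ hg ?_ _ ?_
          · rw [norm_smul, norm_inv, Complex.norm_real, norm_norm, inv_mul_cancel₀ hx0.ne']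
          · rw [map_smul, hgx, smul_eq_mul, inv_mul_cancel₀ hxc]
          · rw [norm_mul, hz, Complex.norm_real, norm_norm, div_mul_cancel₀ _ hx0.ne']
      refine h1.trans ?_
      rw [div_pow, div_div_eq_mul_div, div_mul_eq_mul_div]
      gcongr
      linarith
    · rw [mul_comm]
      gcongr
      exact Real.exp_one_lt_three
  have hq0 : 0 ≤ s / s₁ := by positivity
  have hq1 : ‖s / s₁‖ < 1 := by
    rw [Real.norm_of_nonneg hq0, div_lt_one hs₁0]; exact hs₁
  have hsum : Summable fun m : ℕ => 9 * (C + 1) * (((m : ℝ) ^ 1 * (s / s₁) ^ m) + (s / s₁) ^ m) :=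
    ((summable_pow_mul_geometric_of_norm_lt_one 1 hq1).add
      (summable_geometric_of_norm_lt_one hq1)).mul_left _
  refine ⟨max ‖h 0‖ (∑' m : ℕ, 9 * (C + 1) * (((m : ℝ) ^ 1 * (s / s₁) ^ m) + (s / s₁) ^ m)),
    fun x hx => ?_⟩
  rcases eq_or_ne x 0 with rfl | hx0
  · exact le_max_left _ _
  refine le_trans ?_ (le_max_right _ _)
  have hxn : 0 < ‖x‖ := norm_pos_iff.2 hx0
  have hxc : (‖x‖ : ℂ) ≠ 0 := by exact_mod_cast hxn.ne'
  have hu : ‖(‖x‖ : ℂ)⁻¹ • x‖ = 1 := by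
    rw [norm_smul, norm_inv, Complex.norm_real, norm_norm, inv_mul_cancel₀ hxn.ne']
  have hxs := hasSum_homogeneousPart hh (x := (‖x‖ : ℂ)⁻¹ • x) (z := (‖x‖ : ℂ))
    (by rw [hu, Complex.norm_real, norm_norm, mul_one]; linarith)
  rw [smul_inv_smul₀ hxc] at hxs
  refine hxs.norm_le_of_bounded hsum.hasSum fun m => ?_
  rw [norm_smul, norm_pow, Complex.norm_real, norm_norm]
  calc ‖x‖ ^ m * ‖homogeneousPart h m ((‖x‖ : ℂ)⁻¹ • x)‖
      ≤ s ^ m * (3 * ((m + 1) * (3 * ((C + 1) / s₁ ^ m)))) := by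
        gcongr
        exact bound m _ hu
    _ = _ := by rw [div_pow]; ring

end Harris

/-! ### Radial retraction and global forward solutions. -/

section RealODE

variable {E : Type*} [NormedAddCommGroup E] [NormedSpace ℝ E]

/-- The radial retraction of a normed space onto the closed ball of radius `r`. -/
noncomputable def radialRetraction (r : ℝ) (x : E) : E :=
  if ‖x‖ ≤ r then x else (r / ‖x‖) • x

theorem radialRetraction_of_norm_le {r : ℝ} {x : E} (hx : ‖x‖ ≤ r) : radialRetraction r x = x :=
  if_pos hx

theorem radialRetraction_of_lt_norm {r : ℝ} {x : E} (hx : r < ‖x‖) :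
    radialRetraction r x = (r / ‖x‖) • x :=
  if_neg (not_le.2 hx)

theorem norm_radialRetraction_le {r : ℝ} (hr : 0 < r) (x : E) : ‖radialRetraction r x‖ ≤ r := by
  rcases le_or_gt ‖x‖ r with hx | hx
  · rwa [radialRetraction_of_norm_le hx]
  · rw [radialRetraction_of_lt_norm hx, norm_smul, Real.norm_of_nonneg (by positivity),
      div_mul_cancel₀ _ (hr.trans hx).ne']

theorem norm_sub_radialRetraction_le {r : ℝ} (hr : 0 < r) {x y : E} (hx : ‖x‖ ≤ r)
    (hy : r < ‖y‖) : ‖x - radialRetraction r y‖ ≤ 2 * ‖x - y‖ := by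
  have hy0 : 0 < ‖y‖ := hr.trans hy
  have h1 : ‖y - radialRetraction r y‖ = ‖y‖ - r := by
    have e : y - (r / ‖y‖) • y = (1 - r / ‖y‖) • y := by rw [sub_smul, one_smul]
    rw [radialRetraction_of_lt_norm hy, e, norm_smul, Real.norm_of_nonneg]
    · field_simp
    · rw [sub_nonneg, div_le_one hy0]; exact hy.le
  have h2 := norm_sub_le_norm_sub_add_norm_sub x y (radialRetraction r y)
  have h3 := norm_sub_norm_le y x
  rw [norm_sub_rev y x] at h3
  linarith

/-- Composition with the retraction extends a bounded Lipschitz field from the closed ball to the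
whole space, with the same bound. -/
theorem norm_radialRetraction_sub_le {r : ℝ} (hr : 0 < r) (x y : E) :
    ‖radialRetraction r x - radialRetraction r y‖ ≤ 2 * ‖x - y‖ := by
  rcases le_or_gt ‖x‖ r with hx | hx <;> rcases le_or_gt ‖y‖ r with hy | hy
  · rw [radialRetraction_of_norm_le hx, radialRetraction_of_norm_le hy]
    linarith [norm_nonneg (x - y)]
  · rw [radialRetraction_of_norm_le hx]
    exact norm_sub_radialRetraction_le hr hx hy
  · rw [radialRetraction_of_norm_le hy, norm_sub_rev, norm_sub_rev x y]
    exact norm_sub_radialRetraction_le hr hy hx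
  · have hx0 : 0 < ‖x‖ := hr.trans hx
    have hy0 : 0 < ‖y‖ := hr.trans hy
    rw [radialRetraction_of_lt_norm hx, radialRetraction_of_lt_norm hy]
    have e : (r / ‖x‖) • x - (r / ‖y‖) • y =
        (r / ‖x‖) • (x - y) + (r / ‖x‖ - r / ‖y‖) • y := by
      rw [smul_sub, sub_smul]; abel
    have h1 : ‖(r / ‖x‖) • (x - y)‖ ≤ ‖x - y‖ := by
      rw [norm_smul, Real.norm_of_nonneg (by positivity)]
      exact mul_le_of_le_one_left (norm_nonneg _) ((div_le_one hx0).2 hx.le)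
    have h2 : ‖(r / ‖x‖ - r / ‖y‖) • y‖ ≤ ‖x - y‖ := by
      have e2 : (r / ‖x‖ - r / ‖y‖) = (r / ‖x‖) * ((‖y‖ - ‖x‖) / ‖y‖) := by field_simp
      rw [norm_smul, e2, norm_mul, norm_div (‖y‖ - ‖x‖), norm_norm, mul_assoc,
        div_mul_cancel₀ _ hy0.ne', Real.norm_of_nonneg (show 0 ≤ r / ‖x‖ by positivity)]
      refine (mul_le_of_le_one_left (norm_nonneg _) ((div_le_one hx0).2 hx.le)).trans ?_
      rw [norm_sub_rev x y]
      exact abs_norm_sub_norm_le y x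
    rw [e]
    exact (norm_add_le _ _).trans (by linarith)

/-- Global forward solutions of `x' = H x` for a bounded Lipschitz vector field. -/
theorem exists_forward_solution [CompleteSpace E] {H : E → E} {K : NNReal} {M : ℝ}
    (hK : LipschitzWith K H)
    (hM : ∀ x, ‖H x‖ ≤ M) (x₀ : E) :
    ∃ x : ℝ → E, x 0 = x₀ ∧ ∀ t, 0 ≤ t → HasDerivWithinAt x (H (x t)) (Ici 0) t := by
  have hM0 : 0 ≤ M := (norm_nonneg _).trans (hM 0)
  have loc : ∀ n : ℕ, ∃ α : ℝ → E, α 0 = x₀ ∧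
      ∀ t ∈ Icc (0 : ℝ) (n + 1), HasDerivWithinAt α (H (α t)) (Icc 0 (n + 1)) t := by
    intro n
    have hn : (0 : ℝ) ≤ n + 1 := by positivity
    -- The Picard ball has radius M(n+1), which a field bounded by M cannot leave within the time
    -- interval, so the interval need not shrink.
    have hPL : IsPicardLindelof (fun _ : ℝ => H) (tmin := 0) (tmax := n + 1)
        ⟨0, left_mem_Icc.2 hn⟩ x₀ (⟨M, hM0⟩ * ⟨n + 1, hn⟩) 0 ⟨M, hM0⟩ K :=
      { lipschitzOnWith := fun _ _ => hK.lipschitzOnWith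
        continuousOn := fun _ _ => continuousOn_const
        norm_le := fun _ _ x _ => hM x
        mul_max_le := by simp [hn]; exact le_rfl }
    exact hPL.exists_eq_forall_mem_Icc_hasDerivWithinAt₀
  choose α hα0 hα using loc
  have right : ∀ n : ℕ, ∀ b ≤ (n : ℝ) + 1, ∀ t ∈ Ico 0 b,
      HasDerivWithinAt (α n) (H (α n t)) (Ici t) t := fun n b hb t ht =>
    (hα n t ⟨ht.1, (ht.2.trans_le hb).le⟩).mono_of_mem_nhdsWithin
      (Icc_mem_nhdsGE_of_mem ⟨ht.1, ht.2.trans_le hb⟩)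
  have cont : ∀ n : ℕ, ∀ b ≤ (n : ℝ) + 1, ContinuousOn (α n) (Icc 0 b) := fun n b hb t ht =>
    ((hα n t ⟨ht.1, ht.2.trans hb⟩).continuousWithinAt).mono (Icc_subset_Icc_right hb)
  have agree : ∀ m n : ℕ, m ≤ n → EqOn (α m) (α n) (Icc 0 (m + 1)) := by
    intro m n hmn
    have hmn' : (m : ℝ) + 1 ≤ n + 1 := by gcongr
    exact ODE_solution_unique_of_mem_Icc_right (v := fun _ => H) (s := fun _ => univ)
      (fun _ _ => hK.lipschitzOnWith) (cont m _ le_rfl) (right m _ le_rfl) (fun _ _ => mem_univ _)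
      (cont n _ hmn') (right n _ hmn') (fun _ _ => mem_univ _) (by rw [hα0, hα0])
  -- At time t the solution on [0, ⌊t⌋+1] is used; `t` lies strictly below the right end, so this
  -- piece covers a one-sided neighbourhood.
  let x : ℝ → E := fun t => α ⌊t⌋₊ t
  have hx : ∀ n : ℕ, ∀ t : ℝ, 0 ≤ t → t < n + 1 → x t = α n t := by
    intro n t ht htn
    have : ⌊t⌋₊ ≤ n := by
      rw [← Nat.lt_succ_iff, Nat.floor_lt ht]; push_cast; exact htn
    exact agree _ _ this ⟨ht, (Nat.lt_floor_add_one t).le⟩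
  refine ⟨x, by simp [x, hα0], fun t ht => ?_⟩
  have htn := Nat.lt_floor_add_one t
  have hmem : Icc (0 : ℝ) (⌊t⌋₊ + 1) ∈ 𝓝[Ici 0] t := by
    rw [← Ici_inter_Iic]
    exact inter_mem self_mem_nhdsWithin (nhdsWithin_le_nhds (Iic_mem_nhds htn))
  have h1 := (hα ⌊t⌋₊ t ⟨ht, htn.le⟩).mono_of_mem_nhdsWithin hmem
  refine h1.congr_of_eventuallyEq ?_ rfl
  filter_upwards [self_mem_nhdsWithin, nhdsWithin_le_nhds (Iio_mem_nhds htn)] with τ h0 h2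
  exact hx _ τ h0 h2

end RealODE

/-! ### Inward pointing fields leave the ball invariant. -/

section Invariance

variable {X : Type*} [NormedAddCommGroup X] [NormedSpace ℂ X]

/-- A trajectory of an inward pointing vector field does not leave the ball. -/
theorem norm_lt_of_inward {H : X → X} {r : ℝ}
    (hin : ∀ x : X, ‖x‖ = r → ∀ f ∈ dualityMap x, (f (H x)).re < 0) {x : ℝ → X}
    (hx0 : ‖x 0‖ < r) (hx : ∀ t, 0 ≤ t → HasDerivWithinAt x (H (x t)) (Ici 0) t)
    {t : ℝ} (ht : 0 ≤ t) : ‖x t‖ < r := by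
  by_contra hcon
  push Not at hcon
  have hcont : ContinuousOn x (Ici 0) := fun τ hτ => (hx τ hτ).continuousWithinAt
  let S : Set ℝ := {τ ∈ Icc 0 t | r ≤ ‖x τ‖}
  have hScl : IsClosed S := by
    have h1 : ContinuousOn (fun τ => ‖x τ‖) (Icc 0 t) :=
      (hcont.mono Icc_subset_Ici_self).norm
    exact h1.preimage_isClosed_of_isClosed isClosed_Icc isClosed_Ici
  have hSne : S.Nonempty := ⟨t, ⟨ht, le_rfl⟩, hcon⟩
  have hSbd : BddBelow S := ⟨0, fun τ hτ => hτ.1.1⟩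
  set T := sInf S with hT
  have hTS : T ∈ S := hScl.csInf_mem hSne hSbd
  have hT0 : 0 < T := by
    refine lt_of_le_of_ne hTS.1.1 fun h0 => ?_
    have := hTS.2
    rw [← h0] at this
    linarith
  have hbefore : ∀ τ ∈ Ico 0 T, ‖x τ‖ < r := by
    intro τ hτ
    by_contra hh
    push Not at hh
    have : T ≤ τ := csInf_le hSbd ⟨⟨hτ.1, hτ.2.le.trans hTS.1.2⟩, hh⟩
    exact absurd hτ.2 (not_lt.2 this)
  have hderiv : HasDerivAt x (H (x T)) T := (hx T hT0.le).hasDerivAt (Ici_mem_nhds hT0)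
  have hbelow : ∀ᶠ τ in 𝓝[<] T, ‖x τ‖ < r := by
    filter_upwards [Ioo_mem_nhdsLT hT0] with τ hτ using hbefore τ ⟨hτ.1.le, hτ.2⟩
  have hTr : ‖x T‖ = r := by
    refine le_antisymm ?_ hTS.2
    exact le_of_tendsto (hderiv.continuousAt.norm.tendsto.mono_left nhdsWithin_le_nhds)
      (hbelow.mono fun τ hτ => hτ.le)
  -- At the first exit time T, Re f(x(T)) = r² and its derivative is negative, so Re f(x(τ)) > r²
  -- just before T. But ‖f‖ = r and ‖x(τ)‖ < r there.
  obtain ⟨f, hf⟩ := dualityMap_nonempty (x T)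
  have hfn : ‖f‖ = r := by
    rw [← hTr]
    exact (pow_left_inj₀ (norm_nonneg _) (norm_nonneg _) two_ne_zero).1 hf.2
  have hr0 : 0 < r := (norm_nonneg _).trans_lt hx0
  have hφ : HasDerivAt (fun τ => (f (x τ)).re) ((f (H (x T))).re) T := by
    have h1 := ((Complex.reCLM.comp (f.restrictScalars ℝ)).hasFDerivAt).comp_hasDerivAt T hderiv
    simpa [Function.comp_def] using h1
  have hslope := hasDerivAt_iff_tendsto_slope.1 hφ
  have hneg := ((hslope.mono_left (nhdsWithin_mono T (show Iio T ⊆ {T}ᶜ from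
    fun τ hτ => ne_of_lt hτ)))).eventually_lt_const (hin _ hTr f hf)
  obtain ⟨τ, h1, h2, h3⟩ := (hneg.and (hbelow.and self_mem_nhdsWithin)).exists
  have h3' : τ < T := h3
  rw [slope_def_field, div_lt_iff_of_neg (by linarith), zero_mul, sub_pos] at h1
  have h4 : (f (x T)).re = r ^ 2 := by rw [hf.1, hTr]; exact Complex.ofReal_re _
  have h5 : (f (x τ)).re ≤ r * ‖x τ‖ := by
    rw [← hfn]
    exact (Complex.re_le_norm _).trans (f.le_opNorm _)
  nlinarith

theorem isSemiComplete_of_inward [CompleteSpace X] {h : X → X} {r M K : ℝ} (hr : 0 < r)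
    (hM : ∀ x : X, ‖x‖ ≤ r → ‖h x‖ ≤ M)
    (hK : ∀ x y : X, ‖x‖ ≤ r → ‖y‖ ≤ r → ‖h x - h y‖ ≤ K * ‖x - y‖)
    (hin : ∀ x : X, ‖x‖ = r → ∀ f ∈ dualityMap x, (f (h x)).re < 0) :
    IsSemiComplete (-h) (ball 0 r) := by
  intro x₀ hx₀
  have hlip : LipschitzWith (Real.toNNReal (|K| * 2)) fun x => h (radialRetraction r x) := by
    refine LipschitzWith.of_dist_le_mul fun x y => ?_
    rw [dist_eq_norm, dist_eq_norm, Real.coe_toNNReal _ (by positivity), mul_assoc]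
    refine (hK _ _ (norm_radialRetraction_le hr x) (norm_radialRetraction_le hr y)).trans ?_
    exact mul_le_mul (le_abs_self K) (norm_radialRetraction_sub_le hr x y) (norm_nonneg _)
      (abs_nonneg K)
  obtain ⟨x, hx0, hx⟩ := exists_forward_solution hlip
    (fun y => hM _ (norm_radialRetraction_le hr y)) x₀
  have hlt : ∀ t, 0 ≤ t → ‖x t‖ < r := fun t ht =>
    norm_lt_of_inward (H := fun x => h (radialRetraction r x))
      (fun y hy f hf => by
        simp only [radialRetraction_of_norm_le hy.le]
        exact hin y hy f hf)
      (by rw [hx0]; simpa using hx₀) hx ht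
  refine ⟨x, hx0, fun t ht => ⟨by simpa using hlt t ht, ?_⟩⟩
  have := hx t ht
  rw [radialRetraction_of_norm_le (hlt t ht).le] at this
  simpa using this

end Invariance

/-! ### Necessity: invariance forces L ≤ 0. -/

section Converse

variable {X : Type*} [NormedAddCommGroup X] [NormedSpace ℂ X]

/-- Near the boundary of an invariant ball, the vector field cannot point outward too much. -/
theorem re_le_of_isSemiComplete {h : X → X} {r M K : ℝ} (hM0 : 0 ≤ M) (hK0 : 0 ≤ K)
    (hM : ∀ x : X, ‖x‖ ≤ r → ‖h x‖ ≤ M)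
    (hK : ∀ x y : X, ‖x‖ ≤ r → ‖y‖ ≤ r → ‖h x - h y‖ ≤ K * ‖x - y‖)
    (hsc : IsSemiComplete (-h) (ball 0 r)) {x₀ : X} (hx₀ : ‖x₀‖ < r) {f : X →L[ℂ] ℂ}
    (hf : f ∈ dualityMap x₀) :
    (f (h x₀)).re ≤ ‖x₀‖ * (√(r - ‖x₀‖) * (1 + K * M)) := by
  obtain ⟨x, hx0, hx⟩ := hsc x₀ (by simpa using hx₀)
  have hxr : ∀ t, 0 ≤ t → ‖x t‖ ≤ r := fun t ht => by
    have := (hx t ht).1; simp only [mem_ball_zero_iff] at this; exact this.le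
  have hxd : ∀ t, 0 ≤ t → HasDerivWithinAt x (h (x t)) (Ici 0) t := fun t ht => by
    simpa using (hx t ht).2
  -- The trajectory can gain at most r − ‖x₀‖ = t² in the direction of `f`, and the first-order
  -- expansion has error K·M·t². Division by t leaves a bound of order t, which vanishes at the
  -- boundary.
  set t := √(r - ‖x₀‖) with ht
  have hrs : 0 < r - ‖x₀‖ := by linarith
  have ht0 : 0 < t := Real.sqrt_pos.2 hrs
  have ht2 : t ^ 2 = r - ‖x₀‖ := Real.sq_sqrt hrs.le
  have h1 : ∀ τ ∈ Icc 0 t, ‖x τ - x₀‖ ≤ M * τ := by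
    intro τ hτ
    have := norm_image_sub_le_of_norm_deriv_le_segment' (f := x) (f' := fun σ => h (x σ))
      (a := 0) (b := t) (C := M)
      (fun σ hσ => (hxd σ hσ.1).mono Icc_subset_Ici_self) (fun σ hσ => hM _ (hxr σ hσ.1)) τ hτ
    simpa [hx0] using this
  have h2 : ‖(x t - t • h x₀) - x₀‖ ≤ K * (M * t) * t := by
    have := norm_image_sub_le_of_norm_deriv_le_segment' (f := fun σ => x σ - σ • h x₀)
      (f' := fun σ => h (x σ) - h x₀) (a := 0) (b := t) (C := K * (M * t))
      (fun σ hσ => ?_) (fun σ hσ => ?_) t (right_mem_Icc.2 ht0.le)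
    · simpa [hx0] using this
    · have h3 : HasDerivWithinAt (fun σ : ℝ => σ • h x₀) ((1 : ℝ) • h x₀) (Icc 0 t) σ :=
        (hasDerivWithinAt_id σ _).smul_const _
      rw [one_smul] at h3
      exact ((hxd σ hσ.1).mono Icc_subset_Ici_self).sub h3
    · refine (hK _ _ (hxr σ hσ.1) hx₀.le).trans ?_
      gcongr
      exact (h1 σ ⟨hσ.1, hσ.2.le⟩).trans (by gcongr; exact hσ.2.le)
  have hfn : ‖f‖ = ‖x₀‖ := (pow_left_inj₀ (norm_nonneg _) (norm_nonneg _) two_ne_zero).1 hf.2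
  have hfle : ∀ y, ‖f y‖ ≤ ‖x₀‖ * ‖y‖ := fun y => by rw [← hfn]; exact f.le_opNorm y
  have h4 : -(‖x₀‖ * (K * (M * t) * t)) ≤ (f ((x t - t • h x₀) - x₀)).re :=
    (abs_le.1 ((Complex.abs_re_le_norm _).trans
      ((hfle _).trans (mul_le_mul_of_nonneg_left h2 (norm_nonneg _))))).1
  have h5 : (f (x t)).re ≤ ‖x₀‖ * r :=
    (Complex.re_le_norm _).trans ((hfle _).trans
      (mul_le_mul_of_nonneg_left (hxr t ht0.le) (norm_nonneg _)))
  have h6 : (f ((x t - t • h x₀) - x₀)).re = (f (x t)).re - t * (f (h x₀)).re - ‖x₀‖ ^ 2 := by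
    have e : f (t • h x₀) = (t : ℂ) * f (h x₀) := by
      rw [← Complex.coe_smul, map_smul, smul_eq_mul]
    rw [map_sub, map_sub, e, hf.1, Complex.sub_re, Complex.sub_re, Complex.re_ofReal_mul,
      Complex.ofReal_re]
  have h7 : t * (f (h x₀)).re ≤ t * (‖x₀‖ * (t * (1 + K * M))) := by
    have e : ‖x₀‖ * r = ‖x₀‖ * (t ^ 2 + ‖x₀‖) := by rw [ht2]; ring
    nlinarith
  exact le_of_mul_le_mul_left h7 ht0

/-- Since h(0) = 0, the quotient is just φ(z)/z. Its real part on |z| = s is at most a quantity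
tending to 0 as s → r, and by the maximum principle so is its value at 0, which is g(h'(0)u). -/
theorem derivNumericalSup_nonpos_of_isSemiComplete {h : X → X} {r M K : ℝ} (hr : 0 < r)
    (hh : DifferentiableOn ℂ h (ball 0 r)) (h0 : h 0 = 0) (hM0 : 0 ≤ M) (hK0 : 0 ≤ K)
    (hM : ∀ x : X, ‖x‖ ≤ r → ‖h x‖ ≤ M)
    (hK : ∀ x y : X, ‖x‖ ≤ r → ‖y‖ ≤ r → ‖h x - h y‖ ≤ K * ‖x - y‖)
    (hsc : IsSemiComplete (-h) (ball 0 r)) : derivNumericalSup h ≤ 0 := by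
  refine Real.sSup_le ?_ le_rfl
  rintro a ⟨u, hu, g, hg, rfl⟩
  have hu1 : ‖u‖ = 1 := by simpa using hu
  have hg1 : ‖g‖ = 1 := by
    have := hg.2
    rw [hu1] at this
    exact (pow_left_inj₀ (norm_nonneg _) zero_le_one two_ne_zero).1 (by simpa using this)
  have hgu : g u = 1 := by have := hg.1; rw [hu1] at this; simpa using this
  let φ : ℂ → ℂ := fun z => g (h (z • u))
  have hφ : DifferentiableOn ℂ φ (ball 0 r) :=
    g.differentiable.comp_differentiableOn (differentiableOn_slice hh hu1)
  have hφ0 : φ 0 = 0 := by simp [φ, h0]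
  let B : ℝ → ℝ := fun s => √(r - s) * (1 + K * M) / s
  have hB : Tendsto B (𝓝[<] r) (𝓝 0) := by
    have : ContinuousAt B r := by
      have := hr.ne'
      fun_prop (disch := positivity)
    have h1 := this.tendsto
    simp only [B, sub_self, Real.sqrt_zero, zero_mul, zero_div] at h1
    exact h1.mono_left nhdsWithin_le_nhds
  refine ge_of_tendsto hB ?_
  filter_upwards [Ioo_mem_nhdsLT hr] with s hs
  rw [← deriv_slice_zero hr hh u g, ← regularizedQuotient_zero _ r]
  refine Complex.re_le_of_forall_mem_sphere hs.1 hs.2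
    (differentiableOn_regularizedQuotient hr hφ) (fun z hz => ?_) (by simpa using hs.1.le)
  have hzn : ‖z • u‖ = s := by rw [norm_smul, hu1, mul_one, hz]
  have h2 := re_le_of_isSemiComplete hM0 hK0 hM hK hsc (x₀ := z • u) (by rw [hzn]; exact hs.2)
    (smul_mem_dualityMap hu1 hg1 hgu z)
  have h3 := re_conj_mul_eq φ r z
  rw [hφ0, mul_zero, Complex.zero_re, mul_zero, add_zero, hz] at h3
  have h4 : s ^ 2 * (regularizedQuotient φ r z).re ≤ s * (√(r - s) * (1 + K * M)) := by
    rw [← h3]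
    simpa [hzn, φ] using h2
  rw [le_div_iff₀ hs.1]
  have h5 : s * ((regularizedQuotient φ r z).re * s) ≤ s * (√(r - s) * (1 + K * M)) := by
    linarith
  exact le_of_mul_le_mul_left h5 hs.1

end Converse

/-! ### Roots of μ. -/

section Algebra

/-- The cubic polynomial `r (R + r) μ (r)`. -/
noncomputable def muNumerator (R L b c r : ℝ) : ℝ :=
  (R - r) * r * L + 2 * r ^ 2 * b + c * (R - r) * (R + r) ^ 2 / R ^ 2

theorem muFun_eq_div {R L b c r : ℝ} (hR : 0 < R) (hr : 0 < r) :
    muFun R L b c r = muNumerator R L b c r / (r * (R + r)) := by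
  unfold muFun muNumerator
  field_simp
  ring

theorem continuous_muNumerator (R L b c : ℝ) : Continuous (muNumerator R L b c) := by
  unfold muNumerator
  fun_prop

/-- Strict convexity on intervals up to R: the last factor in `key` is the second divided
difference. As x + y + z ≤ 3R, it is at least 2b − L − 4c/R, which is positive because b ≥ 0 and 4c
< R(b − L). -/
theorem muNumerator_lt_chord {R L b c x y z : ℝ} (hR : 0 < R) (hb : 0 ≤ b) (hc : 0 ≤ c)
    (hA : 4 * c < R * (b - L)) (hxy : x < y) (hyz : y < z) (hz : z ≤ R) :
    muNumerator R L b c y * (z - x) <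
      muNumerator R L b c x * (z - y) + muNumerator R L b c z * (y - x) := by
  have key : muNumerator R L b c x * (z - y) + muNumerator R L b c z * (y - x) -
      muNumerator R L b c y * (z - x) = (z - x) * (z - y) * (y - x) *
        (2 * b - L - c / R - c / R ^ 2 * (x + y + z)) := by
    unfold muNumerator
    field_simp
    ring
  have h1 : c / R ^ 2 * (x + y + z) ≤ c / R ^ 2 * (3 * R) := by
    gcongr
    linarith
  have h2 : c / R ^ 2 * (3 * R) = 3 * (c / R) := by field_simp
  have h3 : 4 * (c / R) < b - L := by
    rw [← mul_div_assoc, div_lt_iff₀ hR]; linarith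
  have h4 : 0 < (z - x) * (z - y) * (y - x) *
      (2 * b - L - c / R - c / R ^ 2 * (x + y + z)) := by
    have : 0 < z - x := by linarith
    have : 0 < z - y := by linarith
    have : 0 < y - x := by linarith
    have : 0 < 2 * b - L - c / R - c / R ^ 2 * (x + y + z) := by linarith
    positivity
  linarith

/-- The condition 4c < R(b − L) says exactly that β > 2, and r_*/R is the smaller root of t² − βt +
1, whose roots are positive with product 1. This is all that is used about r_*. -/
theorem rStar_mem_Ioo {R L b c : ℝ} (hR : 0 < R) (hc : 0 < c) (hA : 4 * c < R * (b - L)) :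
    rStar R L b c ∈ Ioo 0 R := by
  have hβ : 2 < betaConst R L b c := by
    unfold betaConst
    rw [lt_div_iff₀ hc]
    have : 3 * c < √(c ^ 2 + 2 * R * (b - L) * c) := by
      apply Real.lt_sqrt_of_sq_lt
      nlinarith
    linarith
  unfold rStar
  set β := betaConst R L b c
  have h1 : √(β ^ 2 - 4) < β := by
    rw [Real.sqrt_lt' (by linarith)]; linarith
  have h2 : β - 2 < √(β ^ 2 - 4) := by
    apply Real.lt_sqrt_of_sq_lt
    nlinarith
  constructor
  · exact mul_pos hR (by linarith)
  · nlinarith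

theorem exists_roots_muFun {R L b c ρ : ℝ} (hR : 0 < R) (hb : 0 ≤ b) (hc : 0 < c)
    (hA : 4 * c < R * (b - L)) (hρ : ρ ∈ Ioo 0 R) (hneg : muFun R L b c ρ < 0) :
    ∃ r₁ r₂ : ℝ, 0 < r₁ ∧ r₁ < ρ ∧ ρ < r₂ ∧ r₂ ≤ R ∧
      {r | r ∈ Ioc 0 R ∧ muFun R L b c r = 0} = {r₁, r₂} ∧
      ∀ r ∈ Ioo r₁ r₂, muFun R L b c r < 0 := by
  have hden : ∀ r, 0 < r → 0 < r * (R + r) := fun r hr => mul_pos hr (by linarith)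
  have hzero : ∀ r, 0 < r → (muFun R L b c r = 0 ↔ muNumerator R L b c r = 0) := fun r hr => by
    rw [muFun_eq_div hR hr, div_eq_zero_iff, or_iff_left (hden r hr).ne']
  have hlt : ∀ r, 0 < r → (muFun R L b c r < 0 ↔ muNumerator R L b c r < 0) := fun r hr => by
    rw [muFun_eq_div hR hr, div_lt_iff₀ (hden r hr), zero_mul]
  have hcont := continuous_muNumerator R L b c
  have p0 : 0 < muNumerator R L b c 0 := by
    have : muNumerator R L b c 0 = c * R := by unfold muNumerator; field_simp; ring
    rw [this]; positivity
  have pR : 0 ≤ muNumerator R L b c R := by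
    have : muNumerator R L b c R = 2 * R ^ 2 * b := by unfold muNumerator; ring
    rw [this]; positivity
  have pρ := (hlt ρ hρ.1).1 hneg
  obtain ⟨r₁, hr₁, hp₁⟩ := intermediate_value_Ioo' hρ.1.le hcont.continuousOn
    (show (0 : ℝ) ∈ Ioo _ _ from ⟨pρ, p0⟩)
  -- The interval is closed at R because the numerator vanishes there when b = 0.
  obtain ⟨r₂, hr₂, hp₂⟩ := intermediate_value_Ioc hρ.2.le hcont.continuousOn
    (show (0 : ℝ) ∈ Ioc _ _ from ⟨pρ, pR⟩)
  have h12 : r₁ < r₂ := hr₁.2.trans hr₂.1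
  -- Strict convexity excludes a third root: the middle one of three would have a negative value.
  have hbetween : ∀ x y z, x < y → y < z → z ≤ R → muNumerator R L b c x = 0 →
      muNumerator R L b c z = 0 → muNumerator R L b c y < 0 := by
    intro x y z hxy hyz hz hx hz0
    have := muNumerator_lt_chord hR hb hc.le hA hxy hyz hz
    rw [hx, hz0] at this
    by_contra hcon
    push Not at hcon
    have := mul_nonneg hcon (by linarith : 0 ≤ z - x)
    linarith
  refine ⟨r₁, r₂, hr₁.1, hr₁.2, hr₂.1, hr₂.2, ?_, ?_⟩
  · ext r
    simp only [mem_ofPred_eq, mem_insert_iff, mem_singleton_iff]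
    constructor
    · rintro ⟨hr, h0⟩
      rw [hzero r hr.1] at h0
      by_contra hcon
      push Not at hcon
      rcases lt_or_gt_of_ne hcon.1 with h | h
      · exact (hbetween r r₁ r₂ h h12 hr₂.2 h0 hp₂).ne hp₁
      · rcases lt_or_gt_of_ne hcon.2 with h' | h'
        · exact (hbetween r₁ r r₂ h h' hr₂.2 hp₁ hp₂).ne h0
        · exact (hbetween r₁ r₂ r h12 h' hr.2 hp₁ h0).ne hp₂
    · have hr₂0 : 0 < r₂ := hr₁.1.trans h12
      rintro (rfl | rfl)
      · exact ⟨⟨hr₁.1, h12.le.trans hr₂.2⟩, (hzero _ hr₁.1).2 hp₁⟩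
      · exact ⟨⟨hr₂0, hr₂.2⟩, (hzero _ hr₂0).2 hp₂⟩
  · intro r hr
    exact (hlt r (hr₁.1.trans hr.1)).2 (hbetween r₁ r r₂ hr.1 hr.2 hr₂.2 hp₁ hp₂)

end Algebra

/-! ### Sufficiency: negative μ gives semi-completeness. -/

section SemiComplete

variable {X : Type*} [NormedAddCommGroup X] [NormedSpace ℂ X] [CompleteSpace X]

theorem exists_bound_and_lipschitz {h : X → X} {R r : ℝ} (hR : 0 < R) (hr : 0 < r) (hrR : r < R)
    (hh : DifferentiableOn ℂ h (ball 0 R)) (hN : BddAbove (reNumericalValues h (ball 0 R))) :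
    ∃ M K : ℝ, 0 ≤ M ∧ 0 ≤ K ∧ (∀ x : X, ‖x‖ ≤ r → ‖h x‖ ≤ M) ∧
      ∀ x y : X, ‖x‖ ≤ r → ‖y‖ ≤ r → ‖h x - h y‖ ≤ K * ‖x - y‖ := by
  obtain ⟨s, hs, hsR⟩ := exists_between hrR
  obtain ⟨M, hM⟩ := exists_norm_le_of_bddAbove_reNumericalValues hR (hr.trans hs).le hsR hh hN
  have hM0 : 0 ≤ M := (norm_nonneg _).trans (hM 0 (by simpa using (hr.trans hs).le))
  refine ⟨M, 2 * M / (s - r), hM0, div_nonneg (by linarith) (by linarith),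
    fun x hx => hM x (hx.trans hs.le), fun x y hx hy => ?_⟩
  exact norm_sub_le_of_bounded hs (hh.mono (ball_subset_ball hsR.le)) (fun z hz => hM z hz.le) hx hy

theorem isSemiComplete_of_muFun_neg {h : X → X} {R r : ℝ} (hr : 0 < r) (hrR : r < R)
    (hh : DifferentiableOn ℂ h (ball 0 R)) (hN : BddAbove (reNumericalValues h (ball 0 R)))
    (hμ : muFun R (derivNumericalSup h) (numericalSup h R / R ^ 2) ‖h 0‖ r < 0) :
    IsSemiComplete (-h) (ball 0 r) := by
  have hR : 0 < R := hr.trans hrR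
  obtain ⟨M, K, -, -, hM, hK⟩ := exists_bound_and_lipschitz hR hr hrR hh hN
  refine isSemiComplete_of_inward hr hM hK fun x hx f hf => ?_
  have hx0 : x ≠ 0 := norm_pos_iff.1 (by rw [hx]; exact hr)
  refine (re_le_sq_mul_muFun hR hh hN hx0 (by rw [hx]; exact hrR) hf).trans_lt ?_
  rw [hx]
  exact mul_neg_of_pos_of_neg (by positivity) hμ

/-- For c = 0 the sign of μ is that of an affine function of r whose root is the given endpoint; N ≥
0 places that root at or below R. -/
theorem lt_and_muFun_neg_of_vanishing {R L N r : ℝ} (hR : 0 < R) (hN : 0 ≤ N) (hL : L < 0)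
    (hr : r ∈ Ioo 0 (-R ^ 3 * L / (2 * N - L * R ^ 2))) :
    r < R ∧ muFun R L (N / R ^ 2) 0 r < 0 := by
  have hLR : 0 < -L * R ^ 2 := mul_pos (by linarith) (by positivity)
  have hd : 0 < 2 * N - L * R ^ 2 := by linarith
  have h1 := hr.2
  rw [lt_div_iff₀ hd] at h1
  have hr0 := hr.1
  have hrR : r < R := by
    by_contra hcon
    push Not at hcon
    have h2 : R * (2 * N - L * R ^ 2) ≤ r * (2 * N - L * R ^ 2) := by gcongr
    have h3 : 0 ≤ R * (2 * N) := by positivity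
    nlinarith
  refine ⟨hrR, ?_⟩
  rw [muFun_eq_div hR hr0]
  refine div_neg_of_neg_of_pos ?_ (by positivity)
  have e : muNumerator R L (N / R ^ 2) 0 r =
      r * (R ^ 3 * L + r * (2 * N - L * R ^ 2)) / R ^ 2 := by
    unfold muNumerator
    field_simp
    ring
  rw [e]
  refine div_neg_of_neg_of_pos (mul_neg_of_pos_of_neg hr0 (by linarith)) (by positivity)

end SemiComplete

/-! ### The main theorem. -/

theorem mainTheorem10 {X : Type*} [NormedAddCommGroup X] [NormedSpace ℂ X] [CompleteSpace X]
    [Nontrivial X] (R : ℝ) (hR : 0 < R) (h : X → X)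
    (hh : DifferentiableOn ℂ h (Metric.ball 0 R))
    (hN : BddAbove (reNumericalValues h (Metric.ball 0 R)))
    (N L b c : ℝ) (hNdef : N = numericalSup h R) (hLdef : L = derivNumericalSup h)
    (hb : b = N / R ^ 2) (hc : c = ‖h 0‖) :
    (h 0 ≠ 0 → R * (N / R ^ 2 - L) > 4 * ‖h 0‖ → muFun R L b c (rStar R L b c) < 0 →
      ∃ r₁ r₂ : ℝ, 0 < r₁ ∧ r₁ < rStar R L b c ∧ rStar R L b c < r₂ ∧ r₂ ≤ R ∧
        {r | r ∈ Set.Ioc 0 R ∧ muFun R L b c r = 0} = {r₁, r₂} ∧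
        ∀ r ∈ Set.Ioo r₁ r₂, IsSemiComplete (-h) (Metric.ball 0 r)) ∧
    (h 0 = 0 →
      (L ≠ 0 → (IsLocallySemiComplete (-h) R ↔ L < min 0 (N / R ^ 2))) ∧
      (L < min 0 (N / R ^ 2) →
        ∀ r ∈ Set.Ioo 0 (-R ^ 3 * L / (2 * N - L * R ^ 2)),
          IsSemiComplete (-h) (Metric.ball 0 r))) := by
  have hN0 : 0 ≤ N := by rw [hNdef]; exact numericalSup_nonneg hR hN
  -- The point x = 0 contributes the value 0, so N ≥ 0 and the condition L < min{0, N/R²} reduces to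
  -- L < 0.
  have hb0 : 0 ≤ N / R ^ 2 := by positivity
  have semi : ∀ r, 0 < r → r < R → muFun R L b c r < 0 → IsSemiComplete (-h) (ball 0 r) := by
    intro r hr hrR hμ
    refine isSemiComplete_of_muFun_neg hr hrR hh hN ?_
    rwa [← hLdef, ← hNdef, ← hb, ← hc]
  constructor
  · intro h0 hA hneg
    have hc0 : 0 < c := by rw [hc]; exact norm_pos_iff.2 h0
    have hA' : 4 * c < R * (b - L) := by rw [hb, hc]; exact hA
    obtain ⟨r₁, r₂, h1, h2, h3, h4, h5, h6⟩ :=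
      exists_roots_muFun hR (by rw [hb]; exact hb0) hc0 hA' (rStar_mem_Ioo hR hc0 hA') hneg
    exact ⟨r₁, r₂, h1, h2, h3, h4, h5, fun r hr =>
      semi r (h1.trans hr.1) (hr.2.trans_le h4) (h6 r hr)⟩
  · intro h0
    have hc0 : c = 0 := by rw [hc, h0, norm_zero]
    have second : L < 0 → ∀ r ∈ Ioo 0 (-R ^ 3 * L / (2 * N - L * R ^ 2)),
        r < R ∧ IsSemiComplete (-h) (ball 0 r) := by
      intro hL r hr
      obtain ⟨hrR, hμ⟩ := lt_and_muFun_neg_of_vanishing hR hN0 hL hr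
      exact ⟨hrR, semi r hr.1 hrR (by rwa [hb, hc0])⟩
    refine ⟨fun hL0 => ⟨?_, fun hL => ?_⟩, fun hL r hr => (second (lt_min_iff.1 hL).1 r hr).2⟩
    · rintro ⟨r, hr, hsc⟩
      obtain ⟨M, K, hM0, hK0, hM, hK⟩ := exists_bound_and_lipschitz hR hr.1 hr.2 hh hN
      have hL := derivNumericalSup_nonpos_of_isSemiComplete hr.1
        (hh.mono (ball_subset_ball hr.2.le)) h0 hM0 hK0 hM hK hsc
      rw [← hLdef] at hL
      have hL' : L < 0 := lt_of_le_of_ne hL hL0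
      exact lt_min hL' (hL'.trans_le hb0)
    · have hLneg := (lt_min_iff.1 hL).1
      have hpos : 0 < -R ^ 3 * L / (2 * N - L * R ^ 2) := by
        have hLR : 0 < -L * R ^ 2 := mul_pos (by linarith) (by positivity)
        refine div_pos ?_ (by linarith)
        have : 0 < -L * R ^ 3 := mul_pos (by linarith) (by positivity)
        linarith
      obtain ⟨r, hr⟩ := exists_between hpos
      exact ⟨r, ⟨hr.1, (second hLneg r hr).1⟩, (second hLneg r hr).2⟩
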